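/- All vector spaces are over $\mathbb{Q}$ and graded over $\mathbb{Z}$. A DGL is a differential graded Lie algebra $L=\bigoplus_{n\in\mathbb{Z}}L_n$ with differential $\partial$ of degree $-1$ (no connectivity or finiteness is assumed); a DGL morphism is a quasi-isomorphism if it induces an isomorphism on $H_*$. Let $k\ge 2$ and $n_1,\dots,n_k\in\mathbb{Z}$, and put $N=n_1+\cdots+n_k$. Let $\mathbb{L}(U)$ be the free graded Lie algebra on generators $u_S$, one for each $S$ with $\emptyset\ne S\subsetneq\{1,\dots,k\}$, of degree $|u_S|=\sum_{i\in S}n_i-1$, with the differential determined by $$\partial u_S=\sum_{S=A\sqcup B,\ \min S\in A,\ B\neq\emptyset}(-1)^{|u_A|}\,\varepsilon(A,B)\,[u_A,u_B],\qquad \varepsilon(A,B)=\prod_{a\in A,\ b\in B,\ b<a}(-1)^{n_an_b}$$ (so each $u_i=u_{\{i\}}$ is a cycle). Let $w\in\mathbb{L}(U)$ be the cycle of degree $N-2$ given by the right-hand side of this formula for $S=\{1,\dots,k\}$. For a DGL $L$ and classes $x_i\in H_{n_i-1}(L)$, $1\le i\le k$, the $k$th order Whitehead bracket set is the (possibly empty)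 set $$[x_1,\dots,x_k]=\bigl\{\overline{\phi(w)}\ \bigm|\ \phi:\mathbb{L}(U)\to L\text{ a DGL morphism such that }\phi(u_i)\text{ represents }x_i\text{ for }1\le i\le k\bigr\}\subseteq H_{N-2}(L).$$ **Proposition.** Let $\varphi:L\to L'$ be a DGL quasi-isomorphism, let $k\ge2$, $n_1,\dots,n_k\in\mathbb{Z}$, and let $x_i\in H_{n_i-1}(L)$ for $1\le i\le k$. Then: 1. $0\in[x_1,\dots,x_k]$ if and only if $0\in[\varphi_*(x_1),\dots,\varphi_*(x_k)]$. 2. The map $\varphi_*:H_{N-2}(L)\to H_{N-2}(L')$ restricts to a bijection from $[x_1,\dots,x_k]$ onto $[\varphi_*(x_1),\dots,\varphi_*(x_k)]$. In particular, $\#[x_1,\dots,x_k]=\#[\varphi_*(x_1),\dots,\varphi_*(x_k)]$. -/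

import Mathlib

universe u v

/-! ## Differential graded Lie algebras over `ℚ` (graded over `ℤ`, differential of degree `-1`) -/

/-- `br` is a graded Lie bracket on `V = ⨁ gr n`. -/
structure IsGradedLie {V : Type*} [AddCommGroup V] [Module ℚ V]
    (gr : ℤ → Submodule ℚ V) (br : V →ₗ[ℚ] V →ₗ[ℚ] V) : Prop where
  internal : DirectSum.IsInternal gr
  br_mem : ∀ {i j : ℤ} {x y : V}, x ∈ gr i → y ∈ gr j → br x y ∈ gr (i + j)
  br_anti : ∀ {i j : ℤ} {x y : V}, x ∈ gr i → y ∈ gr j →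
    br x y = -((-1 : ℚ) ^ (i * j) • br y x)
  jacobi : ∀ {i j l : ℤ} {x y z : V}, x ∈ gr i → y ∈ gr j → z ∈ gr l →
    br x (br y z) = br (br x y) z + (-1 : ℚ) ^ (i * j) • br y (br x z)

/-- `d` is a derivation of degree `-1` of the bracket `br`. -/
structure IsDerivation {V : Type*} [AddCommGroup V] [Module ℚ V]
    (gr : ℤ → Submodule ℚ V) (br : V →ₗ[ℚ] V →ₗ[ℚ] V) (d : V →ₗ[ℚ] V) : Prop where
  d_mem : ∀ {i : ℤ} {x : V}, x ∈ gr i → d x ∈ gr (i - 1)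
  leibniz : ∀ {i : ℤ} {x : V} (y : V), x ∈ gr i →
    d (br x y) = br (d x) y + (-1 : ℚ) ^ i • br x (d y)

/-- A differential graded Lie algebra over `ℚ`, without any connectivity or finiteness assumption. -/
structure DGLie : Type (u + 1) where
  carrier : Type u
  [addCommGroup : AddCommGroup carrier]
  [module : Module ℚ carrier]
  gr : ℤ → Submodule ℚ carrier
  br : carrier →ₗ[ℚ] carrier →ₗ[ℚ] carrier
  d : carrier →ₗ[ℚ] carrier
  isGradedLie : IsGradedLie gr br
  isDerivation : IsDerivation gr br d
  d_d : ∀ x, d (d x) = 0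

attribute [instance] DGLie.addCommGroup DGLie.module

namespace DGLie

/-- The cycles of degree `n`. -/
def cycles (L : DGLie) (n : ℤ) : Submodule ℚ L.carrier := LinearMap.ker L.d ⊓ L.gr n

/-- The boundaries of degree `n`, inside the cycles of degree `n`. -/
def boundaries (L : DGLie) (n : ℤ) : Submodule ℚ (L.cycles n) :=
  (Submodule.map L.d (L.gr (n + 1))).comap (L.cycles n).subtype

/-- The homology `H_n(L)`. -/
abbrev H (L : DGLie) (n : ℤ) : Type _ := L.cycles n ⧸ L.boundaries n

/-- The homology class of a cycle. -/
def cls (L : DGLie) {n : ℤ} (z : L.carrier) (hd : L.d z = 0) (hz : z ∈ L.gr n) : L.H n :=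
  (L.boundaries n).mkQ ⟨z, hd, hz⟩

/-- Morphisms of differential graded Lie algebras. -/
structure Hom (L : DGLie) (L' : DGLie) where
  toFun : L.carrier →ₗ[ℚ] L'.carrier
  map_gr : ∀ {n : ℤ} {x : L.carrier}, x ∈ L.gr n → toFun x ∈ L'.gr n
  map_br : ∀ x y, toFun (L.br x y) = L'.br (toFun x) (toFun y)
  map_d : ∀ x, toFun (L.d x) = L'.d (toFun x)

namespace Hom

variable {L : DGLie.{u}} {L' : DGLie.{v}}

/-- The map induced on cycles. -/
def mapCycles (f : Hom L L') (n : ℤ) : L.cycles n →ₗ[ℚ] L'.cycles n :=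
  f.toFun.restrict fun x hx => by
    refine ⟨?_, f.map_gr hx.2⟩
    have h : L.d x = 0 := hx.1
    change L'.d (f.toFun x) = 0
    rw [← f.map_d, h, map_zero]

/-- The map `f_* : H_n(L) → H_n(L')` induced on homology. -/
def mapH (f : Hom L L') (n : ℤ) : L.H n →ₗ[ℚ] L'.H n :=
  (L.boundaries n).mapQ (L'.boundaries n) (f.mapCycles n) fun x hx => by
    obtain ⟨y, hy, hyx⟩ := hx
    refine ⟨f.toFun y, f.map_gr hy, ?_⟩
    rw [← f.map_d, hyx]
    rfl

/-- A quasi-isomorphism: a morphism inducing isomorphisms in homology in all degrees. -/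
def IsQuasiIso (f : Hom L L') : Prop := ∀ n : ℤ, Function.Bijective (f.mapH n)

end Hom

end DGLie

/-! ## The free graded Lie algebra on a graded set

It is the quotient of the free non-associative algebra `FreeMagma ι →₀ ℚ` by the two-sided ideal
generated by graded antisymmetry and the graded Jacobi identity. -/

namespace FreeGradedLie

variable {ι : Type*}

/-- The degree of a non-associative monomial. -/
def mdeg (deg : ι → ℤ) : FreeMagma ι → ℤ
  | .of i => deg i
  | .mul a b => mdeg deg a + mdeg deg b

/-- A monomial, as an element of the free non-associative algebra. -/
noncomputable def mon (a : FreeMagma ι) : FreeMagma ι →₀ ℚ := Finsupp.single a 1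

/-- The multiplication of the free non-associative algebra. -/
noncomputable def mulNA :
    (FreeMagma ι →₀ ℚ) →ₗ[ℚ] (FreeMagma ι →₀ ℚ) →ₗ[ℚ] (FreeMagma ι →₀ ℚ) :=
  Finsupp.linearCombination ℚ fun a => Finsupp.linearCombination ℚ fun b => mon (a.mul b)

/-- The elements of degree `n` of the free non-associative algebra. -/
noncomputable def grNA (deg : ι → ℤ) (n : ℤ) : Submodule ℚ (FreeMagma ι →₀ ℚ) :=
  Submodule.span ℚ (mon '' {a | mdeg deg a = n})

/-- The multiples by monomials of the relators of a graded Lie algebra. -/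
inductive Rel (deg : ι → ℤ) : (FreeMagma ι →₀ ℚ) → Prop
  | anti (a b : FreeMagma ι) : Rel deg
      (mulNA (mon a) (mon b) + (-1 : ℚ) ^ (mdeg deg a * mdeg deg b) • mulNA (mon b) (mon a))
  | jacobi (a b c : FreeMagma ι) : Rel deg
      (mulNA (mon a) (mulNA (mon b) (mon c)) - mulNA (mulNA (mon a) (mon b)) (mon c)
        - (-1 : ℚ) ^ (mdeg deg a * mdeg deg b) • mulNA (mon b) (mulNA (mon a) (mon c)))
  | mul_left (a : FreeMagma ι) {r : FreeMagma ι →₀ ℚ} : Rel deg r → Rel deg (mulNA (mon a) r)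
  | mul_right (a : FreeMagma ι) {r : FreeMagma ι →₀ ℚ} : Rel deg r → Rel deg (mulNA r (mon a))

/-- The two-sided ideal generated by the relators. -/
noncomputable def relIdeal (deg : ι → ℤ) : Submodule ℚ (FreeMagma ι →₀ ℚ) :=
  Submodule.span ℚ {r | Rel deg r}

/-- The free graded Lie algebra on generators `i : ι` of degree `deg i`. -/
abbrev Carrier (deg : ι → ℤ) : Type _ := (FreeMagma ι →₀ ℚ) ⧸ relIdeal deg

/-- The elements of degree `n` of the free graded Lie algebra. -/
noncomputable def gr (deg : ι → ℤ) (n : ℤ) : Submodule ℚ (Carrier deg) :=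
  (grNA deg n).map (relIdeal deg).mkQ

lemma mulNA_mon (a b : FreeMagma ι) : mulNA (mon a) (mon b) = mon (a.mul b) := by
  simp [mulNA, mon]

lemma mon_mem (deg : ι → ℤ) (a : FreeMagma ι) : mon a ∈ grNA deg (mdeg deg a) :=
  Submodule.subset_span ⟨a, rfl, rfl⟩

lemma lin_ext {S : Submodule ℚ (FreeMagma ι →₀ ℚ)} (h : ∀ a, mon a ∈ S)
    (x : FreeMagma ι →₀ ℚ) : x ∈ S := by
  induction x using Finsupp.induction_linear with
  | zero => exact S.zero_mem
  | add f g hf hg => exact S.add_mem hf hg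
  | single a c =>
    have : Finsupp.single a c = c • mon a := by simp [mon]
    rw [this]
    exact S.smul_mem _ (h a)

lemma grNA_le {deg : ι → ℤ} {n : ℤ} {S : Submodule ℚ (FreeMagma ι →₀ ℚ)}
    (h : ∀ a, mdeg deg a = n → mon a ∈ S) : grNA deg n ≤ S := by
  refine Submodule.span_le.2 ?_
  rintro _ ⟨a, ha, rfl⟩
  exact h a ha

lemma mulNA_mem_grNA {deg : ι → ℤ} {i j : ℤ} {x y : FreeMagma ι →₀ ℚ} (hx : x ∈ grNA deg i)
    (hy : y ∈ grNA deg j) : mulNA x y ∈ grNA deg (i + j) := by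
  have h1 : ∀ a, mdeg deg a = i → grNA deg j ≤ (grNA deg (i + j)).comap (mulNA (mon a)) := by
    intro a ha
    refine grNA_le fun b hb => ?_
    rw [Submodule.mem_comap, mulNA_mon, ← ha, ← hb]
    exact mon_mem deg (a.mul b)
  have h2 : grNA deg i ≤ (grNA deg (i + j)).comap (mulNA.flip y) :=
    grNA_le fun a ha => h1 a ha hy
  exact h2 hx

lemma mulNA_mem_right {deg : ι → ℤ} (x : FreeMagma ι →₀ ℚ) {r : FreeMagma ι →₀ ℚ}
    (hr : r ∈ relIdeal deg) : mulNA x r ∈ relIdeal deg := by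
  have h1 : ∀ a, relIdeal deg ≤ (relIdeal deg).comap (mulNA (mon a)) := fun a =>
    Submodule.span_le.2 fun r hr => Submodule.subset_span (Rel.mul_left a hr)
  exact lin_ext (S := (relIdeal deg).comap (mulNA.flip r)) (fun a => h1 a hr) x

lemma mulNA_mem_left {deg : ι → ℤ} (x : FreeMagma ι →₀ ℚ) {r : FreeMagma ι →₀ ℚ}
    (hr : r ∈ relIdeal deg) : mulNA r x ∈ relIdeal deg := by
  have h1 : ∀ a, relIdeal deg ≤ (relIdeal deg).comap (mulNA.flip (mon a)) := fun a =>
    Submodule.span_le.2 fun r hr => Submodule.subset_span (Rel.mul_right a hr)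
  exact lin_ext (S := (relIdeal deg).comap (mulNA r)) (fun a => h1 a hr) x

/-- The bracket of the free graded Lie algebra. -/
noncomputable def br (deg : ι → ℤ) : Carrier deg →ₗ[ℚ] Carrier deg →ₗ[ℚ] Carrier deg :=
  (relIdeal deg).liftQ
    { toFun := fun x => (relIdeal deg).mapQ (relIdeal deg) (mulNA x)
        fun _ hr => mulNA_mem_right x hr
      map_add' := fun x y => by ext; simp
      map_smul' := fun c x => by ext; simp }
    fun r hr => by
      refine LinearMap.ext fun q => ?_
      obtain ⟨x, rfl⟩ := (relIdeal deg).mkQ_surjective q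
      exact (Submodule.Quotient.mk_eq_zero _).2 (mulNA_mem_left x hr)

lemma br_mk (deg : ι → ℤ) (x y : FreeMagma ι →₀ ℚ) :
    br deg ((relIdeal deg).mkQ x) ((relIdeal deg).mkQ y) = (relIdeal deg).mkQ (mulNA x y) := rfl

lemma anti_mem {deg : ι → ℤ} {i j : ℤ} {x y : FreeMagma ι →₀ ℚ} (hx : x ∈ grNA deg i)
    (hy : y ∈ grNA deg j) : mulNA x y + (-1 : ℚ) ^ (i * j) • mulNA y x ∈ relIdeal deg := by
  have h1 : ∀ a, mdeg deg a = i → grNA deg j ≤ (relIdeal deg).comap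
      (mulNA (mon a) + (-1 : ℚ) ^ (i * j) • mulNA.flip (mon a)) := by
    intro a ha
    refine grNA_le fun b hb => ?_
    subst ha hb
    exact Submodule.subset_span (Rel.anti a b)
  have h2 : grNA deg i ≤ (relIdeal deg).comap
      (mulNA.flip y + (-1 : ℚ) ^ (i * j) • mulNA y) :=
    grNA_le fun a ha => h1 a ha hy
  exact h2 hx

lemma jacobi_mem {deg : ι → ℤ} {i j l : ℤ} {x y z : FreeMagma ι →₀ ℚ} (hx : x ∈ grNA deg i)
    (hy : y ∈ grNA deg j) (hz : z ∈ grNA deg l) :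
    mulNA x (mulNA y z) - mulNA (mulNA x y) z - (-1 : ℚ) ^ (i * j) • mulNA y (mulNA x z)
      ∈ relIdeal deg := by
  have h1 : ∀ a b, mdeg deg a = i → mdeg deg b = j → grNA deg l ≤ (relIdeal deg).comap
      (mulNA (mon a) ∘ₗ mulNA (mon b) - mulNA (mulNA (mon a) (mon b))
        - (-1 : ℚ) ^ (i * j) • mulNA (mon b) ∘ₗ mulNA (mon a)) := by
    intro a b ha hb
    refine grNA_le fun c hc => ?_
    subst ha hb hc
    exact Submodule.subset_span (Rel.jacobi a b c)
  have h2 : ∀ a, mdeg deg a = i → grNA deg j ≤ (relIdeal deg).comap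
      (mulNA (mon a) ∘ₗ mulNA.flip z - mulNA.flip z ∘ₗ mulNA (mon a)
        - (-1 : ℚ) ^ (i * j) • mulNA.flip (mulNA (mon a) z)) :=
    fun a ha => grNA_le fun b hb => h1 a b ha hb hz
  have h3 : grNA deg i ≤ (relIdeal deg).comap
      (mulNA.flip (mulNA y z) - mulNA.flip z ∘ₗ mulNA.flip y
        - (-1 : ℚ) ^ (i * j) • mulNA y ∘ₗ mulNA.flip z) :=
    grNA_le fun a ha => h2 a ha hy
  exact h3 hx

/-- The projection onto the elements of degree `n`. -/
noncomputable def projNA (deg : ι → ℤ) (n : ℤ) : (FreeMagma ι →₀ ℚ) →ₗ[ℚ] (FreeMagma ι →₀ ℚ) :=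
  Finsupp.linearCombination ℚ fun a => if mdeg deg a = n then mon a else 0

lemma projNA_of_mem {deg : ι → ℤ} {n m : ℤ} {x : FreeMagma ι →₀ ℚ} (hx : x ∈ grNA deg m) :
    projNA deg n x = if m = n then x else 0 := by
  have h : grNA deg m ≤ LinearMap.ker (projNA deg n -
      (if m = n then LinearMap.id else 0 : (FreeMagma ι →₀ ℚ) →ₗ[ℚ] _)) := by
    refine grNA_le fun a ha => ?_
    subst ha
    rw [LinearMap.mem_ker]
    by_cases h : mdeg deg a = n <;> simp [projNA, h, mon]
  have h2 := h hx
  rw [LinearMap.mem_ker, LinearMap.sub_apply, sub_eq_zero] at h2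
  rw [h2]
  split_ifs <;> rfl

lemma rel_homogeneous {deg : ι → ℤ} {r : FreeMagma ι →₀ ℚ} (h : Rel deg r) :
    ∃ m, r ∈ grNA deg m := by
  induction h with
  | anti a b =>
    refine ⟨mdeg deg a + mdeg deg b, Submodule.add_mem _ ?_ (Submodule.smul_mem _ _ ?_)⟩
    · exact mulNA_mem_grNA (mon_mem deg a) (mon_mem deg b)
    · rw [add_comm]
      exact mulNA_mem_grNA (mon_mem deg b) (mon_mem deg a)
  | jacobi a b c =>
    have ha := mon_mem deg a
    have hb := mon_mem deg b
    have hc := mon_mem deg c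
    refine ⟨mdeg deg a + (mdeg deg b + mdeg deg c), Submodule.sub_mem _ (Submodule.sub_mem _ ?_ ?_)
      (Submodule.smul_mem _ _ ?_)⟩
    · exact mulNA_mem_grNA ha (mulNA_mem_grNA hb hc)
    · rw [← add_assoc]
      exact mulNA_mem_grNA (mulNA_mem_grNA ha hb) hc
    · rw [add_left_comm]
      exact mulNA_mem_grNA hb (mulNA_mem_grNA ha hc)
  | mul_left a _ ih => exact ih.imp' _ fun m hm => mulNA_mem_grNA (mon_mem deg a) hm
  | mul_right a _ ih => exact ih.imp' _ fun m hm => mulNA_mem_grNA hm (mon_mem deg a)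

/-- The projection onto the elements of degree `n`. -/
noncomputable def proj (deg : ι → ℤ) (n : ℤ) : Carrier deg →ₗ[ℚ] Carrier deg :=
  (relIdeal deg).mapQ (relIdeal deg) (projNA deg n) <| by
    refine Submodule.span_le.2 fun r hr => ?_
    obtain ⟨m, hm⟩ := rel_homogeneous hr
    change projNA deg n r ∈ relIdeal deg
    rw [projNA_of_mem hm]
    split_ifs
    · exact Submodule.subset_span hr
    · exact Submodule.zero_mem _

lemma proj_of_mem {deg : ι → ℤ} {n m : ℤ} {x : Carrier deg} (hx : x ∈ gr deg m) :
    proj deg n x = if m = n then x else 0 := by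
  obtain ⟨y, hy, rfl⟩ := hx
  change (relIdeal deg).mkQ (projNA deg n y) = _
  rw [projNA_of_mem hy]
  split_ifs <;> simp

lemma gr_internal (deg : ι → ℤ) : DirectSum.IsInternal (gr deg) := by
  rw [DirectSum.isInternal_submodule_iff_iSupIndep_and_iSup_eq_top]
  constructor
  · intro n
    rw [Submodule.disjoint_def]
    intro x hx hx'
    have h : (⨆ (j : ℤ) (_ : j ≠ n), gr deg j) ≤ LinearMap.ker (proj deg n) :=
      iSup₂_le fun j hj y hy => by
        rw [LinearMap.mem_ker, proj_of_mem hy, if_neg hj]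
    have h2 : proj deg n x = 0 := h hx'
    rwa [proj_of_mem hx, if_pos rfl] at h2
  · rw [eq_top_iff]
    rintro q -
    obtain ⟨x, rfl⟩ := (relIdeal deg).mkQ_surjective q
    exact lin_ext (S := (⨆ n, gr deg n).comap (relIdeal deg).mkQ)
      (fun a => Submodule.mem_iSup_of_mem (mdeg deg a) ⟨_, mon_mem deg a, rfl⟩) x

lemma isGradedLie (deg : ι → ℤ) : IsGradedLie (gr deg) (br deg) where
  internal := gr_internal deg
  br_mem := by
    rintro i j _ _ ⟨x, hx, rfl⟩ ⟨y, hy, rfl⟩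
    exact ⟨_, mulNA_mem_grNA hx hy, rfl⟩
  br_anti := by
    rintro i j _ _ ⟨x, hx, rfl⟩ ⟨y, hy, rfl⟩
    rw [eq_neg_iff_add_eq_zero]
    exact (Submodule.Quotient.mk_eq_zero _).2 (anti_mem hx hy)
  jacobi := by
    rintro i j l _ _ _ ⟨x, hx, rfl⟩ ⟨y, hy, rfl⟩ ⟨z, hz, rfl⟩
    rw [← sub_eq_zero, ← sub_sub]
    exact (Submodule.Quotient.mk_eq_zero _).2 (jacobi_mem hx hy hz)

/-- The derivation of the free non-associative algebra with prescribed values on generators,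
on monomials. -/
noncomputable def derMon (deg : ι → ℤ) (δ : ι → FreeMagma ι →₀ ℚ) :
    FreeMagma ι → FreeMagma ι →₀ ℚ
  | .of i => δ i
  | .mul a b => mulNA (derMon deg δ a) (mon b) + (-1 : ℚ) ^ mdeg deg a • mulNA (mon a) (derMon deg δ b)

/-- The derivation of the free non-associative algebra with prescribed values on generators. -/
noncomputable def derNA (deg : ι → ℤ) (δ : ι → FreeMagma ι →₀ ℚ) :
    (FreeMagma ι →₀ ℚ) →ₗ[ℚ] (FreeMagma ι →₀ ℚ) :=
  Finsupp.linearCombination ℚ (derMon deg δ)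

lemma derNA_mon (deg : ι → ℤ) (δ : ι → FreeMagma ι →₀ ℚ) (a : FreeMagma ι) :
    derNA deg δ (mon a) = derMon deg δ a := by
  simp [derNA, mon]

lemma derNA_mem {deg : ι → ℤ} {δ : ι → FreeMagma ι →₀ ℚ} (hδ : ∀ i, δ i ∈ grNA deg (deg i - 1))
    {n : ℤ} {x : FreeMagma ι →₀ ℚ} (hx : x ∈ grNA deg n) :
    derNA deg δ x ∈ grNA deg (n - 1) := by
  have h : ∀ a, derMon deg δ a ∈ grNA deg (mdeg deg a - 1) := by
    intro a
    induction a with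
    | ih1 i => exact hδ i
    | ih2 a b iha ihb =>
      refine Submodule.add_mem _ ?_ (Submodule.smul_mem _ _ ?_)
      · have := mulNA_mem_grNA iha (mon_mem deg b)
        rwa [sub_add_eq_add_sub] at this
      · have := mulNA_mem_grNA (mon_mem deg a) ihb
        rwa [← add_sub_assoc] at this
  have h2 : grNA deg n ≤ (grNA deg (n - 1)).comap (derNA deg δ) := by
    refine grNA_le fun a ha => ?_
    subst ha
    rw [Submodule.mem_comap, derNA_mon]
    exact h a
  exact h2 hx

lemma derNA_mul {deg : ι → ℤ} {δ : ι → FreeMagma ι →₀ ℚ} {n : ℤ} {x : FreeMagma ι →₀ ℚ}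
    (hx : x ∈ grNA deg n) (y : FreeMagma ι →₀ ℚ) :
    derNA deg δ (mulNA x y) =
      mulNA (derNA deg δ x) y + (-1 : ℚ) ^ n • mulNA x (derNA deg δ y) := by
  have h1 : ∀ a b, derNA deg δ (mulNA (mon a) (mon b)) = mulNA (derNA deg δ (mon a)) (mon b)
      + (-1 : ℚ) ^ mdeg deg a • mulNA (mon a) (derNA deg δ (mon b)) := by
    intro a b
    rw [mulNA_mon, derNA_mon, derNA_mon, derNA_mon, derMon]
  have h2 : ∀ a, mdeg deg a = n → derNA deg δ ∘ₗ mulNA (mon a) =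
      mulNA (derNA deg δ (mon a)) + (-1 : ℚ) ^ n • mulNA (mon a) ∘ₗ derNA deg δ := by
    intro a ha
    subst ha
    refine LinearMap.ext fun y => sub_eq_zero.1 ?_
    exact lin_ext (S := LinearMap.ker (derNA deg δ ∘ₗ mulNA (mon a) -
      (mulNA (derNA deg δ (mon a)) + (-1 : ℚ) ^ mdeg deg a • mulNA (mon a) ∘ₗ derNA deg δ)))
      (fun b => sub_eq_zero.2 (h1 a b)) y
  have h3 : grNA deg n ≤ LinearMap.ker (derNA deg δ ∘ₗ mulNA.flip y -
      (mulNA.flip y ∘ₗ derNA deg δ + (-1 : ℚ) ^ n • mulNA.flip (derNA deg δ y))) :=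
    grNA_le fun a ha => sub_eq_zero.2 (LinearMap.congr_fun (h2 a ha) y)
  exact sub_eq_zero.1 (h3 hx)

lemma sign_pm (p : ℤ) : (-1 : ℚ) ^ p = 1 ∨ (-1 : ℚ) ^ p = -1 := by
  rcases Int.even_or_odd p with h | h
  · exact Or.inl h.neg_one_zpow
  · exact Or.inr h.neg_one_zpow

lemma sign_mul_left (p q : ℤ) : (-1 : ℚ) ^ (p * q) = ((-1 : ℚ) ^ p) ^ q := zpow_mul _ _ _

lemma sign_sub_one (p : ℤ) : (-1 : ℚ) ^ (p - 1) = -(-1 : ℚ) ^ p := by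
  rw [zpow_sub_one₀ (by norm_num)]; norm_num

lemma sign_add (p q : ℤ) : (-1 : ℚ) ^ (p + q) = (-1 : ℚ) ^ p * (-1 : ℚ) ^ q :=
  zpow_add₀ (by norm_num) p q

lemma derNA_relIdeal {deg : ι → ℤ} {δ : ι → FreeMagma ι →₀ ℚ}
    (hδ : ∀ i, δ i ∈ grNA deg (deg i - 1)) :
    relIdeal deg ≤ (relIdeal deg).comap (derNA deg δ) := by
  refine Submodule.span_le.2 fun r hr => ?_
  change derNA deg δ r ∈ relIdeal deg
  induction hr with
  | anti a b =>
    have ha := mon_mem deg a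
    have hb := mon_mem deg b
    have h1 := anti_mem (derNA_mem hδ ha) hb
    have h2 := Submodule.smul_mem _ ((-1 : ℚ) ^ mdeg deg a) (anti_mem ha (derNA_mem hδ hb))
    have h := Submodule.add_mem _ h1 h2
    convert h using 1
    rw [map_add, map_smul, derNA_mul ha, derNA_mul hb]
    generalize mdeg deg a = p
    generalize mdeg deg b = q
    simp only [mul_sub, sub_mul, one_mul, mul_one, zpow_sub₀ (show (-1 : ℚ) ≠ 0 by norm_num), sign_mul_left]
    rcases sign_pm p with hp | hp <;> rcases sign_pm q with hq | hq <;> simp [hp, hq] <;> module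
  | jacobi a b c =>
    have ha := mon_mem deg a
    have hb := mon_mem deg b
    have hc := mon_mem deg c
    have h1 := jacobi_mem (derNA_mem hδ ha) hb hc
    have h2 := Submodule.smul_mem _ ((-1 : ℚ) ^ mdeg deg a) (jacobi_mem ha (derNA_mem hδ hb) hc)
    have h3 := Submodule.smul_mem _ ((-1 : ℚ) ^ (mdeg deg a + mdeg deg b))
      (jacobi_mem ha hb (derNA_mem hδ hc))
    have h := Submodule.add_mem _ (Submodule.add_mem _ h1 h2) h3
    convert h using 1
    rw [map_sub, map_sub, map_smul, derNA_mul ha, derNA_mul hb, derNA_mul hb, derNA_mul ha,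
      derNA_mul (mulNA_mem_grNA ha hb), derNA_mul ha]
    generalize mdeg deg a = p
    generalize mdeg deg b = q
    simp only [mul_sub, sub_mul, one_mul, mul_one, zpow_sub₀ (show (-1 : ℚ) ≠ 0 by norm_num),
      sign_mul_left, sign_add, map_add, map_smul, LinearMap.add_apply, LinearMap.smul_apply]
    rcases sign_pm p with hp | hp <;> rcases sign_pm q with hq | hq <;> simp [hp, hq] <;> module
  | @mul_left a r hr ih =>
    rw [derNA_mul (mon_mem deg a)]
    exact Submodule.add_mem _ (mulNA_mem_right _ (Submodule.subset_span hr))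
      (Submodule.smul_mem _ _ (mulNA_mem_right _ ih))
  | @mul_right a r hr ih =>
    obtain ⟨m, hm⟩ := rel_homogeneous hr
    rw [derNA_mul hm]
    exact Submodule.add_mem _ (mulNA_mem_left _ ih)
      (Submodule.smul_mem _ _ (mulNA_mem_left _ (Submodule.subset_span hr)))

/-- The derivation of degree `-1` of the free graded Lie algebra whose value on the generator `i`
is the class of `δ i`. -/
noncomputable def der (deg : ι → ℤ) (δ : ι → FreeMagma ι →₀ ℚ)
    (hδ : ∀ i, δ i ∈ grNA deg (deg i - 1)) : Carrier deg →ₗ[ℚ] Carrier deg :=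
  (relIdeal deg).mapQ (relIdeal deg) (derNA deg δ) (derNA_relIdeal hδ)

lemma isDerivation (deg : ι → ℤ) (δ : ι → FreeMagma ι →₀ ℚ)
    (hδ : ∀ i, δ i ∈ grNA deg (deg i - 1)) :
    IsDerivation (gr deg) (br deg) (der deg δ hδ) where
  d_mem := by
    rintro i _ ⟨x, hx, rfl⟩
    exact ⟨_, derNA_mem hδ hx, rfl⟩
  leibniz := by
    rintro i _ y ⟨x, hx, rfl⟩
    obtain ⟨y, rfl⟩ := (relIdeal deg).mkQ_surjective y
    exact congrArg (relIdeal deg).mkQ (derNA_mul hx y)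

/-- The generator `i` of the free graded Lie algebra. -/
noncomputable def gen (deg : ι → ℤ) (i : ι) : Carrier deg := (relIdeal deg).mkQ (mon (.of i))

lemma gen_mem (deg : ι → ℤ) (i : ι) : gen deg i ∈ gr deg (deg i) :=
  ⟨_, mon_mem deg (.of i), rfl⟩

lemma der_gen (deg : ι → ℤ) (δ : ι → FreeMagma ι →₀ ℚ)
    (hδ : ∀ i, δ i ∈ grNA deg (deg i - 1)) (i : ι) :
    der deg δ hδ (gen deg i) = (relIdeal deg).mkQ (δ i) := by
  refine (congrArg (relIdeal deg).mkQ (derNA_mon deg δ (.of i))).trans ?_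
  rw [derMon]

lemma der_der (deg : ι → ℤ) (δ : ι → FreeMagma ι →₀ ℚ)
    (hδ : ∀ i, δ i ∈ grNA deg (deg i - 1))
    (h0 : ∀ i, der deg δ hδ (der deg δ hδ (gen deg i)) = 0) (x : Carrier deg) :
    der deg δ hδ (der deg δ hδ x) = 0 := by
  obtain ⟨x, rfl⟩ := (relIdeal deg).mkQ_surjective x
  refine lin_ext
    (S := LinearMap.ker (der deg δ hδ ∘ₗ der deg δ hδ ∘ₗ (relIdeal deg).mkQ)) (fun a => ?_) x
  change der deg δ hδ (der deg δ hδ ((relIdeal deg).mkQ (mon a))) = 0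
  induction a with
  | ih1 i => exact h0 i
  | ih2 a b iha ihb =>
    have hD := isDerivation deg δ hδ
    have ha : (relIdeal deg).mkQ (mon a) ∈ gr deg (mdeg deg a) := ⟨_, mon_mem deg a, rfl⟩
    have e : (relIdeal deg).mkQ (mon (a * b)) =
        br deg ((relIdeal deg).mkQ (mon a)) ((relIdeal deg).mkQ (mon b)) := by
      rw [br_mk, mulNA_mon]; rfl
    rw [e, hD.leibniz _ ha, map_add, map_smul, hD.leibniz _ (hD.d_mem ha), hD.leibniz _ ha, iha,
      ihb, sign_sub_one]
    simp

end FreeGradedLie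

/-- The free graded Lie algebra on generators `i : ι` of degree `deg i`, with the differential
whose value on the generator `i` is the class of `δ i`. -/
noncomputable def freeDGLie {ι : Type*} (deg : ι → ℤ) (δ : ι → FreeMagma ι →₀ ℚ)
    (hδ : ∀ i, δ i ∈ FreeGradedLie.grNA deg (deg i - 1))
    (h0 : ∀ i, FreeGradedLie.der deg δ hδ (FreeGradedLie.der deg δ hδ (FreeGradedLie.gen deg i)) = 0) :
    DGLie where
  carrier := FreeGradedLie.Carrier deg
  gr := FreeGradedLie.gr deg
  br := FreeGradedLie.br deg
  d := FreeGradedLie.der deg δ hδ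
  isGradedLie := FreeGradedLie.isGradedLie deg
  isDerivation := FreeGradedLie.isDerivation deg δ hδ
  d_d := FreeGradedLie.der_der deg δ hδ h0

/-! ## The differential graded Lie algebra `Lie(U)`

The generators `u_{i_1 … i_s}`, `1 ≤ i_1 < ⋯ < i_s ≤ k`, `1 ≤ s < k`, are indexed by the nonempty
proper subsets `{i_1, …, i_s}` of `Fin k`. -/

namespace FatWedge

variable {k : ℕ}

/-- The degree `n_{i_1} + ⋯ + n_{i_s} - 1` of `u_{i_1 … i_s}`. -/
def udeg (n : Fin k → ℤ) (S : Finset (Fin k)) : ℤ := ∑ i ∈ S, n i - 1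

/-- For `S = A ⊔ B`, the Koszul sign of the shuffle of `S` which lists first the elements of `A` and
then those of `B`, the index `i` having degree `n i`: each inversion, i.e. each pair `a ∈ A`,
`b ∈ B` with `b < a`, contributes `(-1) ^ (n a * n b)`. -/
def koszul (n : Fin k → ℤ) (A B : Finset (Fin k)) : ℚ :=
  ∏ a ∈ A, ∏ b ∈ B, if b < a then (-1 : ℚ) ^ (n a * n b) else 1

/-- The sum `∑ (-1)^{|u_A|} ε(A, B) [u_A, u_B]` over all the decompositions `S = A ⊔ B` with `A` and
`B` nonempty and `A` containing the least element of `S`; these correspond to the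
shuffles of `S` which fix its first element. -/
def shuffleSum {V : Type*} [AddCommGroup V] [Module ℚ V] (n : Fin k → ℤ)
    (br : V →ₗ[ℚ] V →ₗ[ℚ] V) (u : Finset (Fin k) → V) (S : Finset (Fin k)) : V :=
  ∑ A ∈ S.ssubsets with ∃ m ∈ A, ∀ i ∈ S, m ≤ i,
    ((-1 : ℚ) ^ udeg n A * koszul n A (S \ A)) • br (u A) (u (S \ A))

/-- The nonempty proper subsets of `Fin k`. -/
abbrev Index (k : ℕ) : Type := {S : Finset (Fin k) // S.Nonempty ∧ S ≠ Finset.univ}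

/-- The degrees of the generators. -/
def deg (n : Fin k → ℤ) (S : Index k) : ℤ := udeg n S.1

open Classical in
/-- The generator `u_S` in the free non-associative algebra, for `S` nonempty and proper
(and the unused value `0` for other `S`). -/
noncomputable def genNA (S : Finset (Fin k)) : FreeMagma (Index k) →₀ ℚ :=
  if h : S.Nonempty ∧ S ≠ Finset.univ then FreeGradedLie.mon (.of ⟨S, h⟩) else 0

/-- The differential on generators: `∂ u_S = ∑ (-1)^{|u_A|} ε(A, B) [u_A, u_B]`, which is `0` if `S`
is a singleton. -/
noncomputable def δ (n : Fin k → ℤ) (S : Index k) : FreeMagma (Index k) →₀ ℚ :=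
  shuffleSum n FreeGradedLie.mulNA genNA S.1

section signs

open FreeGradedLie

lemma sum_disj (n : Fin k → ℤ) {A B : Finset (Fin k)} (h : Disjoint A B) :
    udeg n (A ∪ B) = udeg n A + udeg n B + 1 := by
  rw [udeg, udeg, udeg, Finset.sum_union h]; ring

lemma koszul_union_right (n : Fin k → ℤ) {A B C : Finset (Fin k)} (h : Disjoint B C) :
    koszul n A (B ∪ C) = koszul n A B * koszul n A C := by
  rw [koszul, koszul, koszul, ← Finset.prod_mul_distrib]
  exact Finset.prod_congr rfl fun a _ => Finset.prod_union h

lemma koszul_union_left (n : Fin k → ℤ) {A B C : Finset (Fin k)} (h : Disjoint A B) :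
    koszul n (A ∪ B) C = koszul n A C * koszul n B C := Finset.prod_union h

lemma sign_sum (s : Finset (Fin k)) (f : Fin k → ℤ) :
    ∏ a ∈ s, (-1 : ℚ) ^ f a = (-1 : ℚ) ^ (∑ a ∈ s, f a) := by
  classical
  induction s using Finset.induction_on with
  | empty => simp
  | insert a s ha ih => rw [Finset.prod_insert ha, Finset.sum_insert ha, ih, sign_add]

lemma koszul_sq (n : Fin k → ℤ) (A B : Finset (Fin k)) : koszul n A B * koszul n A B = 1 := by
  rw [koszul, ← Finset.prod_mul_distrib]
  refine Finset.prod_eq_one fun a _ => ?_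
  rw [← Finset.prod_mul_distrib]
  refine Finset.prod_eq_one fun b _ => ?_
  split_ifs
  · rcases sign_pm (n a * n b) with h | h <;> simp [h]
  · simp

lemma koszul_mul_swap (n : Fin k → ℤ) {A B : Finset (Fin k)} (h : Disjoint A B) :
    koszul n A B * koszul n B A = (-1 : ℚ) ^ ((udeg n A + 1) * (udeg n B + 1)) := by
  have e : koszul n B A = ∏ a ∈ A, ∏ b ∈ B, if a < b then (-1 : ℚ) ^ (n b * n a) else 1 :=
    Finset.prod_comm
  rw [e, koszul, ← Finset.prod_mul_distrib]
  have e2 : ∀ a ∈ A, (∏ b ∈ B, if b < a then (-1 : ℚ) ^ (n a * n b) else 1) *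
      (∏ b ∈ B, if a < b then (-1 : ℚ) ^ (n b * n a) else 1) =
      (-1 : ℚ) ^ (n a * ∑ b ∈ B, n b) := by
    intro a ha
    rw [← Finset.prod_mul_distrib, Finset.mul_sum, ← sign_sum]
    refine Finset.prod_congr rfl fun b hb => ?_
    have hne : a ≠ b := fun hab => Finset.disjoint_left.1 h ha (hab ▸ hb)
    rcases lt_or_gt_of_ne hne with hl | hl
    · rw [if_neg hl.not_gt, if_pos hl, one_mul, mul_comm]
    · rw [if_pos hl, if_neg hl.not_gt, mul_one]
  rw [Finset.prod_congr rfl e2, sign_sum, ← Finset.sum_mul]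
  simp [udeg]

lemma koszul_swap (n : Fin k → ℤ) {A B : Finset (Fin k)} (h : Disjoint A B) :
    koszul n B A = (-1 : ℚ) ^ ((udeg n A + 1) * (udeg n B + 1)) * koszul n A B := by
  rw [← koszul_mul_swap n h, mul_right_comm, koszul_sq, one_mul]

end signs

section identity

open FreeGradedLie

variable {V : Type*} [AddCommGroup V] [Module ℚ V] {gr : ℤ → Submodule ℚ V}
  {br : V →ₗ[ℚ] V →ₗ[ℚ] V} {n : Fin k → ℤ} {u : Finset (Fin k) → V}

lemma shuffleSum_mem {S : Finset (Fin k)}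
    (hbr : ∀ {i j : ℤ} {x y : V}, x ∈ gr i → y ∈ gr j → br x y ∈ gr (i + j))
    (hu : ∀ A, u A ∈ gr (udeg n A)) : shuffleSum n br u S ∈ gr (udeg n S - 1) := by
  refine Submodule.sum_mem _ fun A hA => Submodule.smul_mem _ _ ?_
  have hAS : A ⊆ S := (Finset.mem_ssubsets.1 (Finset.mem_filter.1 hA).1).1
  have h := sum_disj n (A := A) (B := S \ A) Finset.disjoint_sdiff
  rw [Finset.union_sdiff_of_subset hAS] at h
  rw [h, add_sub_cancel_right]
  exact hbr (hu A) (hu _)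

/-- The general term of the shuffle sum. -/
def term (n : Fin k → ℤ) (br : V →ₗ[ℚ] V →ₗ[ℚ] V) (u : Finset (Fin k) → V)
    (A B : Finset (Fin k)) : V :=
  ((-1 : ℚ) ^ udeg n A * koszul n A B) • br (u A) (u B)

lemma term_symm (hG : IsGradedLie gr br) (hu : ∀ A, u A ∈ gr (udeg n A))
    {A B : Finset (Fin k)} (h : Disjoint A B) : term n br u B A = term n br u A B := by
  rw [term, term, koszul_swap n h, hG.br_anti (hu B) (hu A)]
  simp only [add_mul, mul_add, one_mul, mul_one, sign_add, sign_mul_left]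
  rcases sign_pm (udeg n A) with hp | hp <;> rcases sign_pm (udeg n B) with hq | hq <;>
    simp [hp, hq]

lemma two_shuffleSum (hG : IsGradedLie gr br) (hu : ∀ A, u A ∈ gr (udeg n A)) (h0 : u ∅ = 0)
    (S : Finset (Fin k)) :
    (2 : ℚ) • shuffleSum n br u S = ∑ A ∈ S.powerset, term n br u A (S \ A) := by
  classical
  rcases S.eq_empty_or_nonempty with rfl | hS
  · simp [shuffleSum, term, h0]
  have hmin : ∀ A ⊆ S, ((∃ m ∈ A, ∀ i ∈ S, m ≤ i) ↔ S.min' hS ∈ A) := by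
    intro A hA
    constructor
    · rintro ⟨m, hm, hmi⟩
      have : m = S.min' hS := le_antisymm (hmi _ (S.min'_mem hS)) (S.min'_le m (hA hm))
      exact this ▸ hm
    · intro h
      exact ⟨_, h, fun i hi => S.min'_le i hi⟩
  have e1 : shuffleSum n br u S =
      ∑ A ∈ S.powerset with S.min' hS ∈ A, term n br u A (S \ A) := by
    refine Finset.sum_subset_zero_on_sdiff ?_ ?_ fun _ _ => rfl
    · intro A hA
      rw [Finset.mem_filter, Finset.mem_ssubsets] at hA
      rw [Finset.mem_filter, Finset.mem_powerset]
      exact ⟨hA.1.1, (hmin A hA.1.1).1 hA.2⟩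
    · intro A hA
      rw [Finset.mem_sdiff, Finset.mem_filter, Finset.mem_powerset, Finset.mem_filter,
        Finset.mem_ssubsets] at hA
      have hAS : A = S := by
        by_contra hne
        exact hA.2 ⟨hA.1.1.ssubset_of_ne hne, (hmin A hA.1.1).2 hA.1.2⟩
      simp [term, hAS, h0]
  have e2 : ∑ A ∈ S.powerset with ¬ S.min' hS ∈ A, term n br u A (S \ A) =
      ∑ A ∈ S.powerset with S.min' hS ∈ A, term n br u A (S \ A) := by
    refine Finset.sum_nbij' (fun A => S \ A) (fun A => S \ A) ?_ ?_ ?_ ?_ ?_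
    · intro A hA
      rw [Finset.mem_filter, Finset.mem_powerset] at hA ⊢
      exact ⟨Finset.sdiff_subset, Finset.mem_sdiff.2 ⟨S.min'_mem hS, hA.2⟩⟩
    · intro A hA
      rw [Finset.mem_filter, Finset.mem_powerset] at hA ⊢
      exact ⟨Finset.sdiff_subset, fun h => (Finset.mem_sdiff.1 h).2 hA.2⟩
    · intro A hA
      exact Finset.sdiff_sdiff_eq_self (Finset.mem_powerset.1 (Finset.mem_filter.1 hA).1)
    · intro A hA
      exact Finset.sdiff_sdiff_eq_self (Finset.mem_powerset.1 (Finset.mem_filter.1 hA).1)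
    · intro A hA
      rw [Finset.sdiff_sdiff_eq_self (Finset.mem_powerset.1 (Finset.mem_filter.1 hA).1)]
      exact term_symm hG hu Finset.sdiff_disjoint
  rw [← Finset.sum_filter_add_sum_filter_not S.powerset (fun A => S.min' hS ∈ A), e2, ← e1,
    two_smul]

/-- The general term of the sum over the decompositions of a set into three parts. -/
def term₃ (n : Fin k → ℤ) (br : V →ₗ[ℚ] V →ₗ[ℚ] V) (u : Finset (Fin k) → V)
    (A B C : Finset (Fin k)) : V :=
  (koszul n A B * koszul n A C * koszul n B C * (-1 : ℚ) ^ udeg n B) • br (u A) (br (u B) (u C))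

lemma term₃_cyclic (hG : IsGradedLie gr br) (hu : ∀ A, u A ∈ gr (udeg n A))
    {A B C : Finset (Fin k)} (hAB : Disjoint A B) (hAC : Disjoint A C) (hBC : Disjoint B C) :
    term₃ n br u A B C + term₃ n br u B C A + term₃ n br u C A B = 0 := by
  rw [term₃, term₃, term₃, koszul_swap n hAB, koszul_swap n hAC, koszul_swap n hBC,
    hG.jacobi (hu A) (hu B) (hu C), hG.br_anti (hG.br_mem (hu A) (hu B)) (hu C),
    hG.br_anti (hu C) (hu A)]
  simp only [add_mul, mul_add, one_mul, mul_one, sign_add, sign_mul_left]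
  rcases sign_pm (udeg n A) with hp | hp <;> rcases sign_pm (udeg n B) with hq | hq <;>
    rcases sign_pm (udeg n C) with hr | hr <;> simp [hp, hq, hr] <;> module

/-- The sum over all the ordered decompositions of `S` into three parts. -/
def sum₃ (n : Fin k → ℤ) (br : V →ₗ[ℚ] V →ₗ[ℚ] V) (u : Finset (Fin k) → V)
    (S : Finset (Fin k)) : V :=
  ∑ p ∈ S.powerset.sigma fun A => (S \ A).powerset, term₃ n br u p.1 p.2 ((S \ p.1) \ p.2)

lemma sum₃_rotate {V : Type*} [AddCommGroup V] (f : Finset (Fin k) → Finset (Fin k) → Finset (Fin k) → V)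
    (S : Finset (Fin k)) :
    ∑ p ∈ S.powerset.sigma fun A => (S \ A).powerset, f p.1 p.2 ((S \ p.1) \ p.2) =
      ∑ p ∈ S.powerset.sigma fun A => (S \ A).powerset, f p.2 ((S \ p.1) \ p.2) p.1 := by
  refine Finset.sum_nbij' (fun p => ⟨(S \ p.1) \ p.2, p.1⟩) (fun p => ⟨p.2, (S \ p.1) \ p.2⟩)
    ?_ ?_ ?_ ?_ ?_
  · rintro ⟨A, B⟩ h
    simp only [Finset.mem_sigma, Finset.mem_powerset] at h ⊢
    refine ⟨Finset.sdiff_subset.trans Finset.sdiff_subset, fun x hx => ?_⟩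
    have := h.1 hx
    simp only [Finset.mem_sdiff]
    tauto
  · rintro ⟨A, B⟩ h
    simp only [Finset.mem_sigma, Finset.mem_powerset] at h ⊢
    refine ⟨h.2.trans Finset.sdiff_subset, fun x hx => ?_⟩
    simp only [Finset.mem_sdiff] at hx ⊢
    tauto
  · rintro ⟨A, B⟩ h
    simp only [Finset.mem_sigma, Finset.mem_powerset] at h
    have e : (S \ ((S \ A) \ B)) \ A = B := by
      ext x
      have h1 := @h.1 x
      have h2 := @h.2 x
      simp only [Finset.mem_sdiff] at h2 ⊢
      tauto
    simp only [e]
  · rintro ⟨A, B⟩ h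
    simp only [Finset.mem_sigma, Finset.mem_powerset] at h
    have e : (S \ B) \ ((S \ A) \ B) = A := by
      ext x
      have h1 := @h.1 x
      have h2 := @h.2 x
      simp only [Finset.mem_sdiff] at h2 ⊢
      tauto
    simp only [e]
  · rintro ⟨A, B⟩ h
    simp only [Finset.mem_sigma, Finset.mem_powerset] at h
    have e : (S \ ((S \ A) \ B)) \ A = B := by
      ext x
      have h1 := @h.1 x
      have h2 := @h.2 x
      simp only [Finset.mem_sdiff] at h2 ⊢
      tauto
    simp only [e]

lemma sum₃_eq_zero (hG : IsGradedLie gr br) (hu : ∀ A, u A ∈ gr (udeg n A))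
    (S : Finset (Fin k)) : sum₃ n br u S = 0 := by
  have h1 := sum₃_rotate (term₃ n br u) S
  have h2 := sum₃_rotate (fun A B C => term₃ n br u B C A) S
  have h3 : sum₃ n br u S + sum₃ n br u S + sum₃ n br u S = 0 := by
    nth_rw 3 [sum₃]
    nth_rw 2 [sum₃]
    nth_rw 1 [sum₃]
    nth_rw 3 [h1]
    rw [h2]
    nth_rw 2 [h1]
    rw [← Finset.sum_add_distrib, ← Finset.sum_add_distrib]
    refine Finset.sum_eq_zero fun p hp => ?_
    simp only [Finset.mem_sigma, Finset.mem_powerset] at hp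
    have hAB : Disjoint p.1 p.2 := Finset.disjoint_sdiff.mono_right hp.2
    have hAC : Disjoint p.1 ((S \ p.1) \ p.2) :=
      Finset.disjoint_sdiff.mono_right Finset.sdiff_subset
    have := term₃_cyclic hG hu hAB hAC Finset.disjoint_sdiff
    rw [← this]
  have h4 : (3 : ℚ) • sum₃ n br u S = 0 := by rw [← h3]; module
  exact (smul_eq_zero.1 h4).resolve_left (by norm_num)

lemma d_shuffleSum_aux (hG : IsGradedLie gr br) {d : V →ₗ[ℚ] V} (hd : IsDerivation gr br d)
    (hu : ∀ A, u A ∈ gr (udeg n A)) (h0 : u ∅ = 0) (S : Finset (Fin k))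
    (hS : ∀ A ⊂ S, A.Nonempty → d (u A) = shuffleSum n br u A) :
    d (shuffleSum n br u S) = 0 := by
  classical
  have hw : ∀ A, shuffleSum n br u A ∈ gr (udeg n A - 1) := fun A => shuffleSum_mem hG.br_mem hu
  have e1 : (2 : ℚ) • d (shuffleSum n br u S) =
      ∑ A ∈ S.powerset, ((-1 : ℚ) ^ udeg n A * koszul n A (S \ A)) •
        br (shuffleSum n br u A) (u (S \ A)) +
      ∑ A ∈ S.powerset, koszul n A (S \ A) • br (u A) (shuffleSum n br u (S \ A)) := by
    rw [← map_smul, two_shuffleSum hG hu h0, map_sum, ← Finset.sum_add_distrib]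
    refine Finset.sum_congr rfl fun A hA => ?_
    rw [Finset.mem_powerset] at hA
    have hdw : ∀ B C, B ⊆ S → (u C ≠ 0 → C.Nonempty → B ≠ S) →
        (d (u B) = shuffleSum n br u B ∨ u C = 0) := by
      intro B C hB hC
      rcases B.eq_empty_or_nonempty with rfl | hBn
      · left; simp [h0, shuffleSum]
      · by_cases hC0 : u C = 0
        · exact Or.inr hC0
        · refine Or.inl (hS B (hB.ssubset_of_ne (hC hC0 ?_)) hBn)
          rw [Finset.nonempty_iff_ne_empty]
          rintro rfl
          exact hC0 h0
    have k1 : br (d (u A)) (u (S \ A)) = br (shuffleSum n br u A) (u (S \ A)) := by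
      rcases hdw A (S \ A) hA (by rintro - h rfl; simp at h) with h | h <;> simp [h]
    have k2 : br (u A) (d (u (S \ A))) = br (u A) (shuffleSum n br u (S \ A)) := by
      rcases hdw (S \ A) A Finset.sdiff_subset (by
        rintro - ⟨x, hx⟩ h
        have := hA hx
        rw [← h, Finset.mem_sdiff] at this
        exact this.2 hx) with h | h <;> simp [h]
    rw [term, map_smul, hd.leibniz _ (hu A), k1, k2]
    rcases sign_pm (udeg n A) with hp | hp <;> simp [hp]
  have e2 : ∑ A ∈ S.powerset, ((-1 : ℚ) ^ udeg n A * koszul n A (S \ A)) •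
        br (shuffleSum n br u A) (u (S \ A)) =
      ∑ A ∈ S.powerset, koszul n A (S \ A) • br (u A) (shuffleSum n br u (S \ A)) := by
    refine Finset.sum_nbij' (fun A => S \ A) (fun A => S \ A)
      (fun A _ => by simp) (fun A _ => by simp)
      (fun A hA => Finset.sdiff_sdiff_eq_self (Finset.mem_powerset.1 hA))
      (fun A hA => Finset.sdiff_sdiff_eq_self (Finset.mem_powerset.1 hA)) fun A hA => ?_
    rw [Finset.sdiff_sdiff_eq_self (Finset.mem_powerset.1 hA),
      koszul_swap n (A := A) Finset.disjoint_sdiff, hG.br_anti (hw A) (hu (S \ A))]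
    simp only [add_mul, mul_add, sub_mul, one_mul, mul_one, sign_add, sign_mul_left, zpow_sub₀ (show (-1 : ℚ) ≠ 0 by norm_num)]
    rcases sign_pm (udeg n A) with hp | hp <;> rcases sign_pm (udeg n (S \ A)) with hq | hq <;>
      simp [hp, hq]
  have e3 : (2 : ℚ) • ∑ A ∈ S.powerset,
      koszul n A (S \ A) • br (u A) (shuffleSum n br u (S \ A)) = sum₃ n br u S := by
    rw [sum₃, Finset.sum_sigma, Finset.smul_sum]
    refine Finset.sum_congr rfl fun A hA => ?_
    rw [smul_comm, ← map_smul, two_shuffleSum hG hu h0, map_sum, Finset.smul_sum]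
    refine Finset.sum_congr rfl fun B hB => ?_
    rw [Finset.mem_powerset] at hB
    have hk := koszul_union_right n (A := A) (B := B) (C := (S \ A) \ B) Finset.disjoint_sdiff
    rw [Finset.union_sdiff_of_subset hB] at hk
    rw [term, term₃, map_smul, smul_smul, hk]
    congr 1
    ring
  rw [e2, ← two_smul ℚ, e3, sum₃_eq_zero hG hu] at e1
  exact (smul_eq_zero.1 e1).resolve_left (by norm_num)

/-- If `∂ u_A` is the shuffle sum for all nonempty proper subsets `A` of `S`, then the
shuffle sum for `S` is a cycle. -/
lemma d_shuffleSum (hG : IsGradedLie gr br) {d : V →ₗ[ℚ] V} (hd : IsDerivation gr br d)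
    (hu : ∀ A, A.Nonempty → u A ∈ gr (udeg n A)) (S : Finset (Fin k))
    (hS : ∀ A ⊂ S, A.Nonempty → d (u A) = shuffleSum n br u A) :
    d (shuffleSum n br u S) = 0 := by
  classical
  let u' : Finset (Fin k) → V := fun A => if A.Nonempty then u A else 0
  have hu' : ∀ A, A.Nonempty → u' A = u A := fun A hA => if_pos hA
  have h0 : u' ∅ = 0 := if_neg (by simp)
  have hw : ∀ T, shuffleSum n br u' T = shuffleSum n br u T := by
    intro T
    refine Finset.sum_congr rfl fun A hA => ?_
    rw [Finset.mem_filter, Finset.mem_ssubsets] at hA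
    obtain ⟨hA, m, hm, -⟩ := hA
    rw [hu' A ⟨m, hm⟩, hu' (T \ A) (Finset.sdiff_nonempty.2 hA.2)]
  rw [← hw]
  refine d_shuffleSum_aux hG hd (fun A => ?_) h0 S fun A hA hAn => ?_
  · rcases A.eq_empty_or_nonempty with rfl | hA
    · rw [h0]; exact Submodule.zero_mem _
    · rw [hu' A hA]; exact hu A hA
  · rw [hu' A hAn, hw, hS A hA hAn]

end identity

lemma genNA_mem (n : Fin k → ℤ) (S : Finset (Fin k)) :
    genNA S ∈ FreeGradedLie.grNA (deg n) (udeg n S) := by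
  rw [genNA]
  split_ifs with h
  · exact FreeGradedLie.mon_mem (deg n) (.of (⟨S, h⟩ : Index k))
  · exact Submodule.zero_mem _

lemma δ_mem (n : Fin k → ℤ) (S : Index k) : δ n S ∈ FreeGradedLie.grNA (deg n) (deg n S - 1) :=
  shuffleSum_mem FreeGradedLie.mulNA_mem_grNA (genNA_mem n)

/-- The generator `u_S` in the free graded Lie algebra, for `S` nonempty and proper. -/
noncomputable def gen (n : Fin k → ℤ) (S : Finset (Fin k)) : FreeGradedLie.Carrier (deg n) :=
  (FreeGradedLie.relIdeal (deg n)).mkQ (genNA S)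

lemma gen_eq (n : Fin k → ℤ) (S : Index k) : gen n S.1 = FreeGradedLie.gen (deg n) S := by
  rw [gen, genNA, dif_pos S.2, FreeGradedLie.gen]

lemma gen_mem (n : Fin k → ℤ) (S : Finset (Fin k)) :
    gen n S ∈ FreeGradedLie.gr (deg n) (udeg n S) := ⟨_, genNA_mem n S, rfl⟩

lemma mkQ_δ (n : Fin k → ℤ) (S : Index k) : (FreeGradedLie.relIdeal (deg n)).mkQ (δ n S) =
    shuffleSum n (FreeGradedLie.br (deg n)) (gen n) S.1 := by
  rw [δ, shuffleSum, map_sum]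
  rfl

lemma der_gen (n : Fin k → ℤ) {S : Finset (Fin k)} (hS : S.Nonempty) (hS' : S ≠ Finset.univ) :
    FreeGradedLie.der (deg n) (δ n) (δ_mem n) (gen n S) =
      shuffleSum n (FreeGradedLie.br (deg n)) (gen n) S := by
  rw [gen_eq n ⟨S, hS, hS'⟩, FreeGradedLie.der_gen, mkQ_δ]

lemma der_shuffleSum (n : Fin k → ℤ) (S : Finset (Fin k)) :
    FreeGradedLie.der (deg n) (δ n) (δ_mem n)
      (shuffleSum n (FreeGradedLie.br (deg n)) (gen n) S) = 0 :=
  d_shuffleSum (FreeGradedLie.isGradedLie _) (FreeGradedLie.isDerivation _ _ _)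
    (fun A _ => gen_mem n A) S fun _ hA hAn =>
      der_gen n hAn (hA.trans_subset (Finset.subset_univ S)).ne

/-- The differential graded Lie algebra `Lie(U)`: the free graded Lie algebra on the generators
`u_S`, for `S` a nonempty proper subset of `Fin k`, of degree `∑ i ∈ S, n i - 1`, with differential
`∂ u_S = ∑ (-1)^{|u_A|} ε(A, B) [u_A, u_B]`. -/
noncomputable def LieU (n : Fin k → ℤ) : DGLie :=
  freeDGLie (deg n) (δ n) (δ_mem n) fun S => by
    rw [FreeGradedLie.der_gen, mkQ_δ]
    exact der_shuffleSum n S.1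

/-- The generator `u_S` of `Lie(U)`, for `S` nonempty and proper. -/
noncomputable def u (n : Fin k → ℤ) (S : Finset (Fin k)) : (LieU n).carrier := gen n S

/-- The element `w = ∑ (-1)^{|u_A|} ε(A, B) [u_A, u_B]` of `Lie(U)`, the sum being over
the decompositions of the whole set `Fin k`. -/
noncomputable def w (n : Fin k → ℤ) : (LieU n).carrier :=
  shuffleSum n (LieU n).br (u n) Finset.univ

lemma d_u (n : Fin k → ℤ) {S : Finset (Fin k)} (hS : S.Nonempty) (hS' : S ≠ Finset.univ) :
    (LieU n).d (u n S) = shuffleSum n (LieU n).br (u n) S := der_gen n hS hS'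

lemma d_u_singleton (n : Fin k → ℤ) (i : Fin k) : (LieU n).d (u n {i}) = 0 := by
  by_cases h : ({i} : Finset (Fin k)) = Finset.univ
  · have : u n {i} = 0 := by
      change (FreeGradedLie.relIdeal (deg n)).mkQ (genNA {i}) = 0
      rw [genNA, dif_neg (fun h' => h'.2 h), map_zero]
    rw [this, map_zero]
  · rw [d_u n (Finset.singleton_nonempty i) h, shuffleSum]
    refine Finset.sum_eq_zero fun A hA => ?_
    rw [Finset.mem_filter, Finset.mem_ssubsets, Finset.ssubset_singleton_iff] at hA
    obtain ⟨rfl, m, hm, -⟩ := hA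
    exact absurd hm (Finset.notMem_empty m)

lemma u_singleton_mem (n : Fin k → ℤ) (i : Fin k) : u n {i} ∈ (LieU n).gr (n i - 1) := by
  have h := gen_mem n {i}
  rwa [udeg, Finset.sum_singleton] at h

lemma d_w (n : Fin k → ℤ) : (LieU n).d (w n) = 0 := der_shuffleSum n Finset.univ

lemma w_mem (n : Fin k → ℤ) : w n ∈ (LieU n).gr (∑ i, n i - 2) := by
  have h := shuffleSum_mem (gr := (LieU n).gr) (br := (LieU n).br) (n := n) (u := u n)
    (S := Finset.univ) (fun hx hy => (LieU n).isGradedLie.br_mem hx hy) (gen_mem n)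
  rwa [udeg, sub_sub, one_add_one_eq_two] at h

/-- The homology class of the cycle `u_i` of `Lie(U)`. -/
noncomputable def uClass (n : Fin k → ℤ) (i : Fin k) : (LieU n).H (n i - 1) :=
  (LieU n).cls (u n {i}) (d_u_singleton n i) (u_singleton_mem n i)

/-- The homology class of the cycle `w` of `Lie(U)`. -/
noncomputable def wClass (n : Fin k → ℤ) : (LieU n).H (∑ i, n i - 2) :=
  (LieU n).cls (w n) (d_w n) (w_mem n)

end FatWedge

/-- The higher order Whitehead bracket set `[x_1, …, x_k]`: the homology classes of `Φ(w)`, for all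
the morphisms `Φ : Lie(U) → L` such that `Φ(u_i)` represents `x_i` for all `i`. -/
def whiteheadBracket {k : ℕ} {n : Fin k → ℤ} (L : DGLie) (x : ∀ i, L.H (n i - 1)) :
    Set (L.H (∑ i, n i - 2)) :=
  {y | ∃ Φ : DGLie.Hom (FatWedge.LieU n) L,
    (∀ i, Φ.mapH (n i - 1) (FatWedge.uClass n i) = x i) ∧
      Φ.mapH (∑ i, n i - 2) (FatWedge.wClass n) = y}

/-! Composing with `φ` carries the first bracket set into the second, and `φ_*` is injective because
`φ` is a quasi-isomorphism. The content is surjectivity: every morphism `ψ : LieU n → L'` must be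
lifted to some `Φ : LieU n → L` with `φ ∘ Φ` homotopic to `ψ`. Injectivity of `φ_*` then shows that
`Φ(u_i)` represents `x_i` as soon as `ψ(u_i)` represents `φ_*(x_i)`.

Homotopies are paths in `L'[t] ⊕ dt L'[t]`. Three facts about paths suffice, all obtained by
integrating polynomials over `ℚ`: the endpoints of a cycle are homologous
(`exists_d_eq_of_path_cycle`); a cycle whose initial value is `d v` bounds a path starting at `v`
(`exists_path_of_cycle`); every boundary is the endpoint of a cycle starting at `0`
(`exists_path_cycle_of_boundary`).

The lift is built by induction on the cardinality of `S` (`exists_isLiftAt`, `exists_lift`). When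
the elements `v A` and the paths `Γ A` from `ψ(u_A)` to `φ(v A)` are known for all nonempty `A ⊂ S`,
the shuffle sum of the `Γ A` is a cycle starting at `d ψ(u_S)`, so it bounds a path starting at
`ψ(u_S)`. The endpoint of that path is a primitive of the image under `φ` of the shuffle sum of the
`v A`; by `IsQuasiIso.exists_primitive` this sum has a primitive `y` in `L` whose image differs from
the endpoint by a boundary, which is then absorbed into the path. On the whole set, the shuffle sum
of the `Γ A` is a cycle from `ψ(w)` to `φ(Φ(w))`, so these are homologous.

The identity that makes shuffle sums cycles, `d_shuffleSum`, asks only for a graded Lie bracket and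
a derivation of degree `-1`. It therefore applies to the path object without knowing that the path
differential squares to zero. -/

open scoped TensorProduct Polynomial

/-! ### Degree operators and projections on a graded vector space -/

namespace GradedSpace

variable {V : Type*} [AddCommGroup V] [Module ℚ V] {gr : ℤ → Submodule ℚ V}

/-- The operator multiplying the elements of degree `n` by `c n`. -/
lemma exists_scale (h : DirectSum.IsInternal gr) (c : ℤ → ℚ) :
    ∃ T : V →ₗ[ℚ] V, ∀ n, ∀ x ∈ gr n, T x = c n • x := by
  classical
  let e := LinearEquiv.ofBijective (DirectSum.coeLinearMap gr) h
  refine ⟨(DirectSum.toModule ℚ ℤ V fun n => c n • (gr n).subtype) ∘ₗ e.symm.toLinearMap,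
    fun n x hx => ?_⟩
  have hex : e (DirectSum.lof ℚ ℤ (fun n => gr n) n ⟨x, hx⟩) = x :=
    DirectSum.coeLinearMap_lof gr n ⟨x, hx⟩
  have : e.symm x = DirectSum.lof ℚ ℤ (fun n => gr n) n ⟨x, hx⟩ := by
    rw [LinearEquiv.symm_apply_eq, hex]
  simp [this]

lemma exists_proj (h : DirectSum.IsInternal gr) (n : ℤ) :
    ∃ T : V →ₗ[ℚ] V, ∀ m, ∀ x ∈ gr m, T x = if m = n then x else 0 := by
  obtain ⟨T, hT⟩ := exists_scale h fun m => if m = n then 1 else 0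
  exact ⟨T, fun m x hx => by rw [hT m x hx]; split_ifs <;> simp⟩

/-- `T n` is the identity on `gr n` and kills the span of the other pieces, which gives
independence. In this form a grading passes to another space by applying a functor to its
projections, as is done below for `ℚ[X] ⊗ V` and `V × V`. -/
lemma isInternal_of_proj (T : ℤ → V →ₗ[ℚ] V)
    (hT : ∀ n m, ∀ x ∈ gr m, T n x = if m = n then x else 0) (htop : ⨆ n, gr n = ⊤) :
    DirectSum.IsInternal gr := by
  rw [DirectSum.isInternal_submodule_iff_iSupIndep_and_iSup_eq_top]
  refine ⟨fun n => ?_, htop⟩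
  rw [Submodule.disjoint_def]
  intro x hx hx'
  have h : (⨆ (j : ℤ) (_ : j ≠ n), gr j) ≤ LinearMap.ker (T n) :=
    iSup₂_le fun j hj y hy => by rw [LinearMap.mem_ker, hT n j y hy, if_neg hj]
  have h2 : T n x = 0 := h hx'
  rwa [hT n n x hx, if_pos rfl] at h2

/-- The sign operator `x ↦ (-1)^{|x|} x`. -/
noncomputable def sgn (h : DirectSum.IsInternal gr) : V →ₗ[ℚ] V :=
  (exists_scale h fun n => (-1) ^ n).choose

lemma sgn_apply (h : DirectSum.IsInternal gr) {n : ℤ} {x : V} (hx : x ∈ gr n) :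
    sgn h x = (-1 : ℚ) ^ n • x :=
  (exists_scale h fun n => (-1) ^ n).choose_spec n x hx

lemma iSup_eq_top (h : DirectSum.IsInternal gr) : ⨆ n, gr n = ⊤ :=
  ((DirectSum.isInternal_submodule_iff_iSupIndep_and_iSup_eq_top gr).1 h).2

end GradedSpace

/-! ## Polynomials with coefficients in a graded Lie algebra -/

namespace PolyLie

variable {V : Type*} [AddCommGroup V] [Module ℚ V]

/-- The polynomials with homogeneous coefficients of degree `n`. -/
noncomputable def gr (g : ℤ → Submodule ℚ V) (n : ℤ) : Submodule ℚ (ℚ[X] ⊗[ℚ] V) :=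
  LinearMap.range ((g n).subtype.lTensor ℚ[X])

lemma tmul_mem {g : ℤ → Submodule ℚ V} {n : ℤ} (p : ℚ[X]) {x : V} (hx : x ∈ g n) :
    p ⊗ₜ[ℚ] x ∈ gr g n := ⟨p ⊗ₜ ⟨x, hx⟩, rfl⟩

lemma gr_le {g : ℤ → Submodule ℚ V} {n : ℤ} {S : Submodule ℚ (ℚ[X] ⊗[ℚ] V)}
    (h : ∀ p : ℚ[X], ∀ x ∈ g n, p ⊗ₜ[ℚ] x ∈ S) : gr g n ≤ S := by
  rintro _ ⟨y, rfl⟩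
  induction y using TensorProduct.induction_on with
  | zero => rw [map_zero]; exact S.zero_mem
  | tmul p x => exact h p x.1 x.2
  | add y z hy hz => rw [map_add]; exact S.add_mem hy hz

/-- The bracket extended to polynomials. -/
noncomputable def br (b : V →ₗ[ℚ] V →ₗ[ℚ] V) :
    ℚ[X] ⊗[ℚ] V →ₗ[ℚ] ℚ[X] ⊗[ℚ] V →ₗ[ℚ] ℚ[X] ⊗[ℚ] V :=
  TensorProduct.map₂ (LinearMap.mul ℚ ℚ[X]) b

lemma br_tmul (b : V →ₗ[ℚ] V →ₗ[ℚ] V) (p q : ℚ[X]) (x y : V) :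
    br b (p ⊗ₜ x) (q ⊗ₜ y) = (p * q) ⊗ₜ b x y := rfl

lemma lTensor_mem {W : Type*} [AddCommGroup W] [Module ℚ W] {g : ℤ → Submodule ℚ V}
    {g' : ℤ → Submodule ℚ W} {n m : ℤ} {f : V →ₗ[ℚ] W}
    (hf : ∀ {x}, x ∈ g n → f x ∈ g' m) {x : ℚ[X] ⊗[ℚ] V} (hx : x ∈ gr g n) :
    f.lTensor ℚ[X] x ∈ gr g' m := by
  have : gr g n ≤ (gr g' m).comap (f.lTensor ℚ[X]) := gr_le fun p x hx => tmul_mem p (hf hx)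
  exact this hx

lemma rTensor_mem {g : ℤ → Submodule ℚ V} {n : ℤ} (f : ℚ[X] →ₗ[ℚ] ℚ[X])
    {x : ℚ[X] ⊗[ℚ] V} (hx : x ∈ gr g n) : f.rTensor V x ∈ gr g n := by
  have : gr g n ≤ (gr g n).comap (f.rTensor V) := gr_le fun p x hx => tmul_mem (f p) hx
  exact this hx

lemma isInternal {g : ℤ → Submodule ℚ V} (hg : DirectSum.IsInternal g) :
    DirectSum.IsInternal (gr g) := by
  choose T hT using GradedSpace.exists_proj hg
  refine GradedSpace.isInternal_of_proj (fun n => (T n).lTensor ℚ[X]) ?_ ?_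
  · intro n m x hx
    by_cases h : m = n
    · rw [if_pos h]
      have : gr g m ≤ LinearMap.eqLocus ((T n).lTensor ℚ[X]) LinearMap.id :=
        gr_le fun p x hx => by simp [hT n m x hx, h]
      exact this hx
    · rw [if_neg h]
      have : gr g m ≤ LinearMap.ker ((T n).lTensor ℚ[X]) :=
        gr_le fun p x hx => by simp [hT n m x hx, h]
      exact this hx
  · rw [eq_top_iff]
    rintro y -
    induction y using TensorProduct.induction_on with
    | zero => exact Submodule.zero_mem _
    | add y z hy hz => exact Submodule.add_mem _ hy hz
    | tmul p x =>
      have : (⨆ n, g n) ≤ (⨆ n, gr g n).comap (TensorProduct.mk ℚ ℚ[X] V p) :=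
        iSup_le fun n x hx => Submodule.mem_iSup_of_mem n (tmul_mem p hx)
      rw [GradedSpace.iSup_eq_top hg] at this
      exact this trivial

/-- Polynomials have degree `0` and commute, so no new sign appears on pure tensors. The identities
are multilinear: `gr_le` reduces one argument at a time to pure tensors, both sides being read as
linear maps of that argument. -/
lemma isGradedLie {g : ℤ → Submodule ℚ V} {b : V →ₗ[ℚ] V →ₗ[ℚ] V} (h : IsGradedLie g b) :
    IsGradedLie (gr g) (br b) where
  internal := isInternal h.internal
  br_mem := by
    intro i j x y hx hy
    have h1 : ∀ p : ℚ[X], ∀ x ∈ g i, gr g j ≤ (gr g (i + j)).comap (br b (p ⊗ₜ x)) :=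
      fun p x hx => gr_le fun q y hy => tmul_mem (p * q) (h.br_mem hx hy)
    have h2 : gr g i ≤ (gr g (i + j)).comap ((br b).flip y) := gr_le fun p x hx => h1 p x hx hy
    exact h2 hx
  br_anti := by
    intro i j x y hx hy
    have h1 : ∀ p : ℚ[X], ∀ x ∈ g i, gr g j ≤ LinearMap.eqLocus (br b (p ⊗ₜ x))
        (-((-1 : ℚ) ^ (i * j) • (br b).flip (p ⊗ₜ x))) :=
      fun p x hx => gr_le fun q y hy => by
        change (p * q) ⊗ₜ[ℚ] b x y = -((-1 : ℚ) ^ (i * j) • (q * p) ⊗ₜ[ℚ] b y x)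
        rw [h.br_anti hx hy, mul_comm q p, TensorProduct.tmul_neg, TensorProduct.tmul_smul]
    have h2 : gr g i ≤ LinearMap.eqLocus ((br b).flip y) (-((-1 : ℚ) ^ (i * j) • br b y)) :=
      gr_le fun p x hx => h1 p x hx hy
    exact h2 hx
  jacobi := by
    intro i j l x y z hx hy hz
    have h1 : ∀ p : ℚ[X], ∀ x ∈ g i, ∀ q : ℚ[X], ∀ y ∈ g j, gr g l ≤
        LinearMap.eqLocus (br b (p ⊗ₜ x) ∘ₗ br b (q ⊗ₜ y))
          (br b (br b (p ⊗ₜ x) (q ⊗ₜ y)) + (-1 : ℚ) ^ (i * j) • br b (q ⊗ₜ y) ∘ₗ br b (p ⊗ₜ x)) :=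
      fun p x hx q y hy => gr_le fun r z hz => by
        change (p * (q * r)) ⊗ₜ[ℚ] b x (b y z) =
          (p * q * r) ⊗ₜ[ℚ] b (b x y) z + (-1 : ℚ) ^ (i * j) • (q * (p * r)) ⊗ₜ[ℚ] b y (b x z)
        rw [h.jacobi hx hy hz, TensorProduct.tmul_add, TensorProduct.tmul_smul, mul_assoc,
          mul_left_comm q p r]
    have h2 : ∀ p : ℚ[X], ∀ x ∈ g i, gr g j ≤
        LinearMap.eqLocus (br b (p ⊗ₜ x) ∘ₗ (br b).flip z)
          ((br b).flip z ∘ₗ br b (p ⊗ₜ x) +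
            (-1 : ℚ) ^ (i * j) • (br b).flip (br b (p ⊗ₜ x) z)) :=
      fun p x hx => gr_le fun q y hy => h1 p x hx q y hy hz
    have h3 : gr g i ≤ LinearMap.eqLocus ((br b).flip (br b y z))
          ((br b).flip z ∘ₗ (br b).flip y + (-1 : ℚ) ^ (i * j) • br b y ∘ₗ (br b).flip z) :=
      gr_le fun p x hx => h2 p x hx hy
    exact h3 hx

lemma isDerivation {g : ℤ → Submodule ℚ V} {b : V →ₗ[ℚ] V →ₗ[ℚ] V} {d : V →ₗ[ℚ] V}
    (h : IsDerivation g b d) : IsDerivation (gr g) (br b) (d.lTensor ℚ[X]) where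
  d_mem := lTensor_mem h.d_mem
  leibniz := by
    intro i x y hx
    have h1 : ∀ p : ℚ[X], ∀ x ∈ g i, d.lTensor ℚ[X] ∘ₗ br b (p ⊗ₜ x) =
        br b (d.lTensor ℚ[X] (p ⊗ₜ x)) + (-1 : ℚ) ^ i • br b (p ⊗ₜ x) ∘ₗ d.lTensor ℚ[X] := by
      intro p x hx
      refine TensorProduct.ext' fun q y => ?_
      change (p * q) ⊗ₜ[ℚ] d (b x y) =
        (p * q) ⊗ₜ[ℚ] b (d x) y + (-1 : ℚ) ^ i • (p * q) ⊗ₜ[ℚ] b x (d y)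
      rw [h.leibniz y hx, TensorProduct.tmul_add, TensorProduct.tmul_smul]
    have h2 : gr g i ≤ LinearMap.eqLocus (d.lTensor ℚ[X] ∘ₗ (br b).flip y)
        ((br b).flip y ∘ₗ d.lTensor ℚ[X] +
          (-1 : ℚ) ^ i • (br b).flip (d.lTensor ℚ[X] y)) :=
      gr_le fun p x hx => LinearMap.congr_fun (h1 p x hx) y
    exact h2 hx

/-- The derivative of a polynomial with coefficients in `V`. -/
noncomputable def D : ℚ[X] ⊗[ℚ] V →ₗ[ℚ] ℚ[X] ⊗[ℚ] V :=
  (Polynomial.derivative (R := ℚ)).rTensor V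

lemma D_br (b : V →ₗ[ℚ] V →ₗ[ℚ] V) (x y : ℚ[X] ⊗[ℚ] V) :
    D (br b x y) = br b (D x) y + br b x (D y) := by
  have : (br b).compr₂ D = br b ∘ₗ D + (br b).compl₂ D := by
    refine TensorProduct.ext' fun p x => TensorProduct.ext' fun q y => ?_
    change (Polynomial.derivative (p * q)) ⊗ₜ[ℚ] b x y =
      (Polynomial.derivative p * q) ⊗ₜ[ℚ] b x y + (p * Polynomial.derivative q) ⊗ₜ[ℚ] b x y
    rw [Polynomial.derivative_mul, TensorProduct.add_tmul]
  exact LinearMap.congr_fun₂ this x y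

/-- The primitive vanishing at `0` of a polynomial. -/
noncomputable def primitive : ℚ[X] →ₗ[ℚ] ℚ[X] :=
  (Polynomial.basisMonomials ℚ).constr ℚ fun i => Polynomial.monomial (i + 1) (1 / (i + 1 : ℚ))

lemma primitive_monomial (i : ℕ) :
    primitive (Polynomial.monomial i 1) = Polynomial.monomial (i + 1) (1 / (i + 1 : ℚ)) := by
  have := (Polynomial.basisMonomials ℚ).constr_basis ℚ
    (fun i => Polynomial.monomial (i + 1) (1 / (i + 1 : ℚ))) i
  rwa [Polynomial.coe_basisMonomials] at this

/-- The division by `i + 1` uses characteristic zero; it is what makes polynomial paths usable as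
homotopies. -/
lemma derivative_primitive : Polynomial.derivative ∘ₗ primitive = LinearMap.id := by
  refine (Polynomial.basisMonomials ℚ).ext fun i => ?_
  have : (i + 1 : ℚ) ≠ 0 := by positivity
  simp only [Polynomial.coe_basisMonomials, LinearMap.comp_apply, primitive_monomial]
  rw [Polynomial.derivative_monomial]
  simp [this]

lemma primitive_derivative (p : ℚ[X]) :
    primitive (Polynomial.derivative p) = p - Polynomial.C (p.eval 0) := by
  have : primitive ∘ₗ Polynomial.derivative =
      LinearMap.id - (Algebra.linearMap ℚ ℚ[X]) ∘ₗ Polynomial.leval 0 := by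
    refine (Polynomial.basisMonomials ℚ).ext fun i => ?_
    simp only [Polynomial.coe_basisMonomials, LinearMap.comp_apply]
    rw [Polynomial.derivative_monomial]
    rcases i with _ | i
    · simp [Polynomial.leval]
    · have h1 : ((i : ℚ) + 1) ≠ 0 := by positivity
      have : Polynomial.monomial (i + 1 - 1) ((1 : ℚ) * ((i + 1 : ℕ) : ℚ)) =
          ((i : ℚ) + 1) • Polynomial.monomial i (1 : ℚ) := by
        rw [Polynomial.smul_monomial]; simp
      rw [this, map_smul, primitive_monomial, Polynomial.smul_monomial]
      simp [Polynomial.leval, h1]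
  exact LinearMap.congr_fun this p

lemma primitive_eval_zero : Polynomial.leval 0 ∘ₗ primitive = 0 := by
  refine (Polynomial.basisMonomials ℚ).ext fun i => ?_
  simp only [Polynomial.coe_basisMonomials, LinearMap.comp_apply, primitive_monomial]
  simp [Polynomial.leval]

/-- Integration from `0`. -/
noncomputable def J : ℚ[X] ⊗[ℚ] V →ₗ[ℚ] ℚ[X] ⊗[ℚ] V := primitive.rTensor V

/-- Evaluation at `c`. -/
noncomputable def ev (c : ℚ) : ℚ[X] ⊗[ℚ] V →ₗ[ℚ] V :=
  (TensorProduct.lid ℚ V).toLinearMap ∘ₗ (Polynomial.leval c).rTensor V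

lemma ev_tmul (c : ℚ) (p : ℚ[X]) (x : V) : ev c (p ⊗ₜ[ℚ] x) = p.eval c • x := by
  simp [ev, Polynomial.leval]

lemma D_J (x : ℚ[X] ⊗[ℚ] V) : D (J x) = x := by
  rw [D, J, ← LinearMap.comp_apply, ← LinearMap.rTensor_comp, derivative_primitive]
  simp

lemma J_D (x : ℚ[X] ⊗[ℚ] V) : J (D x) = x - 1 ⊗ₜ ev 0 x := by
  have : J ∘ₗ D = LinearMap.id - TensorProduct.mk ℚ ℚ[X] V 1 ∘ₗ ev 0 := by
    refine TensorProduct.ext' fun p x => ?_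
    change primitive (Polynomial.derivative p) ⊗ₜ[ℚ] x = p ⊗ₜ[ℚ] x - 1 ⊗ₜ[ℚ] ev 0 (p ⊗ₜ[ℚ] x)
    rw [primitive_derivative, ev_tmul, ← TensorProduct.smul_tmul, TensorProduct.sub_tmul,
      Polynomial.smul_eq_C_mul, mul_one]
  exact LinearMap.congr_fun this x

/-- Integration acts on the polynomial factor and `d` on the coefficients. -/
lemma J_lTensor (d : V →ₗ[ℚ] V) (x : ℚ[X] ⊗[ℚ] V) :
    J (d.lTensor ℚ[X] x) = d.lTensor ℚ[X] (J x) := by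
  rw [J, ← LinearMap.comp_apply, ← LinearMap.comp_apply, LinearMap.lTensor_comp_rTensor,
    LinearMap.rTensor_comp_lTensor]

lemma ev_zero_J (x : ℚ[X] ⊗[ℚ] V) : ev 0 (J x) = 0 := by
  rw [ev, J, LinearMap.comp_apply, ← LinearMap.rTensor_comp_apply, primitive_eval_zero]
  simp

lemma ev_lTensor (c : ℚ) (d : V →ₗ[ℚ] V) (x : ℚ[X] ⊗[ℚ] V) :
    ev c (d.lTensor ℚ[X] x) = d (ev c x) := by
  have : ev c ∘ₗ d.lTensor ℚ[X] = d ∘ₗ ev c := by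
    refine TensorProduct.ext' fun p x => ?_
    simp [ev_tmul]
  exact LinearMap.congr_fun this x

lemma ev_br (c : ℚ) (b : V →ₗ[ℚ] V →ₗ[ℚ] V) (x y : ℚ[X] ⊗[ℚ] V) :
    ev c (br b x y) = b (ev c x) (ev c y) := by
  have : (br b).compr₂ (ev c) = b.compl₁₂ (ev c) (ev c) := by
    refine TensorProduct.ext' fun p x => TensorProduct.ext' fun q y => ?_
    simp [br_tmul, ev_tmul, smul_smul, mul_comm]
  exact LinearMap.congr_fun₂ this x y

lemma ev_mem {g : ℤ → Submodule ℚ V} {n : ℤ} (c : ℚ) {x : ℚ[X] ⊗[ℚ] V} (hx : x ∈ gr g n) :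
    ev c x ∈ g n := by
  have : gr g n ≤ (g n).comap (ev c) := gr_le fun p x hx => by
    rw [Submodule.mem_comap, ev_tmul]
    exact Submodule.smul_mem _ _ hx
  exact this hx

end PolyLie

/-! ## The path object `V ⊕ dt V` of a graded Lie algebra with a derivation `D = d/dt` -/

namespace DtExtension

open FreeGradedLie (sign_pm sign_add sign_sub_one sign_mul_left)

variable {V : Type*} [AddCommGroup V] [Module ℚ V]

/-- The elements `a + dt b` of degree `n`, the degree of `dt` being `-1`. -/
def gr (g : ℤ → Submodule ℚ V) (n : ℤ) : Submodule ℚ (V × V) := (g n).prod (g (n + 1))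

/-- The bracket `[a + dt b, a' + dt b'] = [a, a'] + dt ([b, a'] + (-1)^{|a|} [a, b'])`, where `σ` is
the sign operator. -/
noncomputable def br (σ : V →ₗ[ℚ] V) (b : V →ₗ[ℚ] V →ₗ[ℚ] V) : V × V →ₗ[ℚ] V × V →ₗ[ℚ] V × V :=
  LinearMap.mk₂ ℚ (fun x y => (b x.1 y.1, b x.2 y.1 + b (σ x.1) y.2))
    (fun x y z => by simp; abel) (fun c x y => by simp)
    (fun x y z => by simp; abel) (fun c x y => by simp)

lemma br_apply (σ : V →ₗ[ℚ] V) (b : V →ₗ[ℚ] V →ₗ[ℚ] V) (x y : V × V) :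
    br σ b x y = (b x.1 y.1, b x.2 y.1 + b (σ x.1) y.2) := rfl

/-- The differential `a + dt b ↦ d a + dt (D a - d b)`. -/
def diff (d D : V →ₗ[ℚ] V) : V × V →ₗ[ℚ] V × V :=
  (d ∘ₗ LinearMap.fst ℚ V V).prod (D ∘ₗ LinearMap.fst ℚ V V - d ∘ₗ LinearMap.snd ℚ V V)

lemma diff_apply (d D : V →ₗ[ℚ] V) (x : V × V) : diff d D x = (d x.1, D x.1 - d x.2) := rfl

variable {g : ℤ → Submodule ℚ V} {b : V →ₗ[ℚ] V →ₗ[ℚ] V} {d D : V →ₗ[ℚ] V}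

lemma isInternal (hg : DirectSum.IsInternal g) : DirectSum.IsInternal (gr g) := by
  choose T hT using GradedSpace.exists_proj hg
  refine GradedSpace.isInternal_of_proj (fun n => (T n).prodMap (T (n + 1))) ?_ ?_
  · rintro n m ⟨x, y⟩ ⟨hx, hy⟩
    change (T n x, T (n + 1) y) = _
    rw [hT _ _ _ hx, hT _ _ _ hy]
    by_cases h : m = n <;> simp [h]
  · rw [eq_top_iff]
    rintro ⟨x, y⟩ -
    have h1 : (⨆ n, g n) ≤ (⨆ n, gr g n).comap (LinearMap.inl ℚ V V) :=
      iSup_le fun n x hx => Submodule.mem_iSup_of_mem n ⟨hx, Submodule.zero_mem _⟩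
    -- Since `dt` has degree `-1`, an element of degree `n` placed in the `dt` component has degree
    -- `n - 1`.
    have h2 : (⨆ n, g n) ≤ (⨆ n, gr g n).comap (LinearMap.inr ℚ V V) :=
      iSup_le fun n x hx => Submodule.mem_iSup_of_mem (n - 1)
        ⟨Submodule.zero_mem _, by simpa using hx⟩
    rw [GradedSpace.iSup_eq_top hg] at h1 h2
    have hx := h1 (show x ∈ ⊤ from trivial)
    have hy := h2 (show y ∈ ⊤ from trivial)
    simpa using Submodule.add_mem (⨆ n, gr g n) hx hy

/-- The first component of each identity is the identity in `V`. The `dt` component is a sum of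
copies of it, in each of which one argument is replaced by its `dt` part, of degree one higher in
`V`. The signs then agree by inspection of parities. -/
lemma isGradedLie (h : IsGradedLie g b) :
    IsGradedLie (gr g) (br (GradedSpace.sgn h.internal) b) where
  internal := isInternal h.internal
  br_mem := by
    rintro i j ⟨x, x'⟩ ⟨y, y'⟩ ⟨hx, hx'⟩ ⟨hy, hy'⟩
    dsimp only at hx hx' hy hy'
    refine ⟨h.br_mem hx hy, Submodule.add_mem _ ?_ ?_⟩
    · have := h.br_mem hx' hy
      rwa [add_right_comm] at this
    · rw [GradedSpace.sgn_apply h.internal hx]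
      have := h.br_mem hx hy'
      rw [← add_assoc] at this
      simpa using Submodule.smul_mem _ _ this
  br_anti := by
    rintro i j ⟨x, x'⟩ ⟨y, y'⟩ ⟨hx, hx'⟩ ⟨hy, hy'⟩
    dsimp only at hx hx' hy hy'
    rw [br_apply, br_apply]
    dsimp only
    rw [GradedSpace.sgn_apply h.internal hx, GradedSpace.sgn_apply h.internal hy]
    refine Prod.ext (h.br_anti hx hy) ?_
    simp only [Prod.snd_neg, Prod.smul_snd, map_smul, LinearMap.smul_apply]
    rw [h.br_anti hx' hy, h.br_anti hx hy']
    simp only [add_mul, mul_add, one_mul, mul_one, sign_add, sign_mul_left]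
    rcases sign_pm i with hp | hp <;> rcases sign_pm j with hq | hq <;> simp [hp, hq]
  jacobi := by
    rintro i j l ⟨x, x'⟩ ⟨y, y'⟩ ⟨z, z'⟩ ⟨hx, hx'⟩ ⟨hy, hy'⟩ ⟨hz, hz'⟩
    dsimp only at hx hx' hy hy' hz hz'
    simp only [br_apply]
    rw [GradedSpace.sgn_apply h.internal hx, GradedSpace.sgn_apply h.internal hy,
      GradedSpace.sgn_apply h.internal (h.br_mem hx hy)]
    refine Prod.ext (h.jacobi hx hy hz) ?_
    simp only [Prod.snd_add, Prod.smul_snd, map_smul, map_add, LinearMap.smul_apply,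
      LinearMap.add_apply]
    rw [h.jacobi hx' hy hz, h.jacobi hx hy' hz, h.jacobi hx hy hz']
    simp only [add_mul, mul_add, one_mul, mul_one, sign_add, sign_mul_left]
    rcases sign_pm i with hp | hp <;> rcases sign_pm j with hq | hq <;> simp [hp, hq] <;> abel

/-- In the `dt` component the rule for `D` has no sign, while the minus sign in front of `d b`
accounts for moving `d` past `dt`. Commutation of `d` and `D` would matter only for the square of
the differential. -/
lemma isDerivation (h : IsGradedLie g b) (hd : IsDerivation g b d)
    (hD : ∀ {n x}, x ∈ g n → D x ∈ g n) (hDb : ∀ x y, D (b x y) = b (D x) y + b x (D y)) :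
    IsDerivation (gr g) (br (GradedSpace.sgn h.internal) b) (diff d D) where
  d_mem := by
    rintro i ⟨x, x'⟩ ⟨hx, hx'⟩
    refine ⟨hd.d_mem hx, Submodule.sub_mem _ ?_ ?_⟩
    · rw [sub_add_cancel]; exact hD hx
    · have := hd.d_mem hx'
      rwa [add_sub_right_comm] at this
  leibniz := by
    rintro i ⟨x, x'⟩ ⟨y, y'⟩ ⟨hx, hx'⟩
    dsimp only at hx hx'
    simp only [br_apply, diff_apply]
    rw [GradedSpace.sgn_apply h.internal hx, GradedSpace.sgn_apply h.internal (hd.d_mem hx)]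
    refine Prod.ext (hd.leibniz y hx) ?_
    simp only [Prod.snd_add, Prod.smul_snd, map_smul, map_add, LinearMap.smul_apply, map_sub,
      LinearMap.sub_apply]
    rw [hd.leibniz _ hx, hd.leibniz _ hx', hDb, sign_add, sign_sub_one]
    rcases sign_pm i with hp | hp <;> simp [hp] <;> abel

end DtExtension

/-! ### Paths in a differential graded Lie algebra and their endpoints -/

namespace DGLie

/-- The underlying vector space of the path object `L[t] ⊕ dt L[t]`. -/
abbrev PathObject (L : DGLie.{v}) : Type v := (ℚ[X] ⊗[ℚ] L.carrier) × (ℚ[X] ⊗[ℚ] L.carrier)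

/-- The bracket of the path object `L[t] ⊕ dt L[t]`. -/
noncomputable def pathBr (L : DGLie.{v}) :
    PathObject L →ₗ[ℚ] PathObject L →ₗ[ℚ] PathObject L :=
  DtExtension.br (GradedSpace.sgn (PolyLie.isGradedLie L.isGradedLie).internal) (PolyLie.br L.br)

/-- The grading of the path object `L[t] ⊕ dt L[t]`. -/
noncomputable def pathGr (L : DGLie.{v}) : ℤ → Submodule ℚ (PathObject L) :=
  DtExtension.gr (PolyLie.gr L.gr)

/-- The differential of the path object `L[t] ⊕ dt L[t]`. -/
noncomputable def pathD (L : DGLie.{v}) : PathObject L →ₗ[ℚ] PathObject L :=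
  DtExtension.diff (L.d.lTensor ℚ[X]) PolyLie.D

variable (L : DGLie.{v})

lemma path_isGradedLie : IsGradedLie L.pathGr L.pathBr :=
  DtExtension.isGradedLie (PolyLie.isGradedLie L.isGradedLie)

lemma path_isDerivation : IsDerivation L.pathGr L.pathBr L.pathD :=
  DtExtension.isDerivation (PolyLie.isGradedLie L.isGradedLie)
    (PolyLie.isDerivation L.isDerivation) (PolyLie.rTensor_mem _) (PolyLie.D_br L.br)

lemma ev_pathBr (c : ℚ) (x y : L.PathObject) :
    PolyLie.ev c (L.pathBr x y).1 = L.br (PolyLie.ev c x.1) (PolyLie.ev c y.1) :=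
  PolyLie.ev_br c L.br x.1 y.1

variable {L}

/-- A cycle of the path object has homologous endpoints. -/
lemma exists_d_eq_of_path_cycle {n : ℤ} {x : L.PathObject} (hx : x ∈ L.pathGr n) (h : L.pathD x = 0) :
    ∃ e ∈ L.gr (n + 1), L.d e = PolyLie.ev 1 x.1 - PolyLie.ev 0 x.1 := by
  have h2 : PolyLie.D x.1 = L.d.lTensor ℚ[X] x.2 := sub_eq_zero.1 (congrArg Prod.snd h)
  -- For a cycle `a + dt b` one has `D a = d b`, so `a(1) - a(0)` is the integral of `d b` over `[0,
  -- 1]`, that is, `d` of the integral of `b`.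
  refine ⟨PolyLie.ev 1 (PolyLie.J x.2), PolyLie.ev_mem 1 (PolyLie.rTensor_mem _ hx.2), ?_⟩
  rw [← PolyLie.ev_lTensor, ← PolyLie.J_lTensor, ← h2, PolyLie.J_D, map_sub, PolyLie.ev_tmul]
  simp

/-- A cycle of the path object whose value at `0` is a boundary `d v` is the boundary of some
path starting at `v`. -/
lemma exists_path_of_cycle {n : ℤ} {x : L.PathObject} (hx : x ∈ L.pathGr (n - 1)) (h : L.pathD x = 0)
    {v : L.carrier} (hv : v ∈ L.gr n) (hdv : L.d v = PolyLie.ev 0 x.1) :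
    ∃ y ∈ L.pathGr n, L.pathD y = x ∧ PolyLie.ev 0 y.1 = v := by
  have h2 : PolyLie.D x.1 = L.d.lTensor ℚ[X] x.2 := sub_eq_zero.1 (congrArg Prod.snd h)
  have hx2 := hx.2
  rw [sub_add_cancel] at hx2
  -- With zero `dt` part, a primitive of `a + dt b` must have derivative `b` and initial value `v`,
  -- which forces this choice. Its differential is `d v` plus the integral of `d b = D a`, which is
  -- `a` because `d v = a(0)`.
  refine ⟨(1 ⊗ₜ v + PolyLie.J x.2, 0), ⟨Submodule.add_mem _ (PolyLie.tmul_mem _ hv)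
    (PolyLie.rTensor_mem _ hx2), Submodule.zero_mem _⟩, Prod.ext ?_ ?_, ?_⟩
  · change L.d.lTensor ℚ[X] (1 ⊗ₜ v + PolyLie.J x.2) = x.1
    rw [map_add, ← PolyLie.J_lTensor, ← h2, PolyLie.J_D, LinearMap.lTensor_tmul, hdv]
    abel
  · change PolyLie.D (1 ⊗ₜ v + PolyLie.J x.2) - L.d.lTensor ℚ[X] 0 = x.2
    rw [map_add, PolyLie.D_J]
    simp [PolyLie.D]
  · rw [map_add, PolyLie.ev_zero_J, PolyLie.ev_tmul]
    simp

/-- Any element `d e` is the endpoint of a boundary starting at `0`. -/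
lemma exists_path_cycle_of_boundary {n : ℤ} {e : L.carrier} (he : e ∈ L.gr (n + 1)) :
    ∃ y ∈ L.pathGr n, L.pathD y = 0 ∧ PolyLie.ev 0 y.1 = 0 ∧ PolyLie.ev 1 y.1 = L.d e := by
  have hde := L.isDerivation.d_mem he
  rw [add_sub_cancel_right] at hde
  -- This is the path differential of `t e`.
  refine ⟨(Polynomial.X ⊗ₜ L.d e, 1 ⊗ₜ e), ⟨PolyLie.tmul_mem _ hde, PolyLie.tmul_mem _ he⟩,
    Prod.ext ?_ ?_, ?_, ?_⟩
  · simp [pathD, DtExtension.diff_apply, L.d_d]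
  · simp [pathD, DtExtension.diff_apply, PolyLie.D]
  · simp [PolyLie.ev_tmul]
  · simp [PolyLie.ev_tmul]

/-! ### Homology classes -/

lemma cls_eq_cls_iff {n : ℤ} {z z' : L.carrier} (hd : L.d z = 0) (hz : z ∈ L.gr n)
    (hd' : L.d z' = 0) (hz' : z' ∈ L.gr n) :
    L.cls z hd hz = L.cls z' hd' hz' ↔ ∃ e ∈ L.gr (n + 1), L.d e = z - z' := by
  change Submodule.Quotient.mk _ = Submodule.Quotient.mk _ ↔ _
  rw [Submodule.Quotient.eq]
  rfl

lemma exists_cls {n : ℤ} (x : L.H n) : ∃ z hd hz, L.cls z hd hz = x := by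
  obtain ⟨⟨z, hd, hz⟩, rfl⟩ := (L.boundaries n).mkQ_surjective x
  exact ⟨z, hd, hz, rfl⟩

namespace Hom

variable {L : DGLie.{u}} {L' : DGLie.{v}}

lemma d_map_eq_zero (f : Hom L L') {z : L.carrier} (hd : L.d z = 0) : L'.d (f.toFun z) = 0 := by
  rw [← f.map_d, hd, map_zero]

lemma mapH_cls (f : Hom L L') {n : ℤ} {z : L.carrier} (hd : L.d z = 0) (hz : z ∈ L.gr n) :
    f.mapH n (L.cls z hd hz) = L'.cls (f.toFun z) (f.d_map_eq_zero hd) (f.map_gr hz) := rfl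

/-- The composition of morphisms. -/
def comp {L'' : DGLie} (g : Hom L' L'') (f : Hom L L') : Hom L L'' where
  toFun := g.toFun ∘ₗ f.toFun
  map_gr hx := g.map_gr (f.map_gr hx)
  map_br x y := by simp [f.map_br, g.map_br]
  map_d x := by simp [f.map_d, g.map_d]

lemma mapH_comp {L'' : DGLie} (g : Hom L' L'') (f : Hom L L') (n : ℤ) (x : L.H n) :
    (g.comp f).mapH n x = g.mapH n (f.mapH n x) := by
  obtain ⟨z, hd, hz, rfl⟩ := exists_cls x
  rfl

/-- A cycle whose image under a quasi-isomorphism is a boundary is a boundary, and the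
primitives can be compared. -/
lemma IsQuasiIso.exists_primitive {f : Hom L L'} (hf : f.IsQuasiIso) {n : ℤ} {z : L.carrier}
    (hd : L.d z = 0) (hz : z ∈ L.gr (n - 1)) {y' : L'.carrier} (hy' : y' ∈ L'.gr n)
    (h : L'.d y' = f.toFun z) :
    ∃ y ∈ L.gr n, L.d y = z ∧ ∃ e ∈ L'.gr (n + 1), L'.d e = f.toFun y - y' := by
  -- Injectivity in degree `n - 1` gives some primitive `y` of `z`, still unrelated to `y'`.
  have h0 : L.cls z hd hz = L.cls 0 (map_zero _) (Submodule.zero_mem _) := by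
    refine (hf (n - 1)).1 ?_
    rw [mapH_cls, mapH_cls, cls_eq_cls_iff]
    exact ⟨y', by rwa [sub_add_cancel], by simp [h]⟩
  rw [cls_eq_cls_iff, sub_add_cancel, sub_zero] at h0
  obtain ⟨y, hy, hyz⟩ := h0
  -- The discrepancy is a cycle. Surjectivity in degree `n` realises its class by a cycle `c` of
  -- `L`, and `y + c` is the corrected primitive.
  have hcd : L'.d (y' - f.toFun y) = 0 := by rw [map_sub, h, ← f.map_d, hyz, sub_self]
  obtain ⟨c, hc⟩ := (hf n).2 (L'.cls (y' - f.toFun y) hcd (Submodule.sub_mem _ hy' (f.map_gr hy)))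
  obtain ⟨c, hdc, hcn, rfl⟩ := exists_cls c
  rw [mapH_cls, cls_eq_cls_iff] at hc
  obtain ⟨e, he, hec⟩ := hc
  refine ⟨y + c, Submodule.add_mem _ hy hcn, by rw [map_add, hdc, hyz, add_zero], e, he, ?_⟩
  rw [hec, map_add]
  abel

end Hom

end DGLie

/-! ## The universal property of free differential graded Lie algebras -/

namespace FreeGradedLie

variable {ι : Type*}

/-- The value of a non-associative monomial in a differential graded Lie algebra. -/
def evalMon (L : DGLie.{v}) (v : ι → L.carrier) : FreeMagma ι → L.carrier
  | .of i => v i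
  | .mul a b => L.br (evalMon L v a) (evalMon L v b)

/-- The value of a non-associative polynomial in a differential graded Lie algebra. -/
noncomputable def evalNA (L : DGLie.{v}) (v : ι → L.carrier) : (FreeMagma ι →₀ ℚ) →ₗ[ℚ] L.carrier :=
  Finsupp.linearCombination ℚ (evalMon L v)

variable {L : DGLie.{v}} {v : ι → L.carrier} {deg : ι → ℤ}

lemma evalNA_mon (a : FreeMagma ι) : evalNA L v (mon a) = evalMon L v a := by
  simp [evalNA, mon]

lemma evalNA_mul (x y : FreeMagma ι →₀ ℚ) :
    evalNA L v (mulNA x y) = L.br (evalNA L v x) (evalNA L v y) := by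
  have h1 : ∀ a, ∀ y, evalNA L v (mulNA (mon a) y) = L.br (evalNA L v (mon a)) (evalNA L v y) :=
    fun a => lin_ext (S := LinearMap.eqLocus (evalNA L v ∘ₗ mulNA (mon a))
      (L.br (evalNA L v (mon a)) ∘ₗ evalNA L v)) fun b => by
        change evalNA L v (mulNA (mon a) (mon b)) = L.br (evalNA L v (mon a)) (evalNA L v (mon b))
        rw [mulNA_mon, evalNA_mon, evalNA_mon, evalNA_mon, evalMon]
  exact lin_ext (S := LinearMap.eqLocus (evalNA L v ∘ₗ mulNA.flip y)
    (L.br.flip (evalNA L v y) ∘ₗ evalNA L v)) (fun a => h1 a y) x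

lemma evalNA_mem (hv : ∀ i, v i ∈ L.gr (deg i)) {n : ℤ} {x : FreeMagma ι →₀ ℚ}
    (hx : x ∈ grNA deg n) : evalNA L v x ∈ L.gr n := by
  have h : ∀ a, evalMon L v a ∈ L.gr (mdeg deg a) := by
    intro a
    induction a with
    | ih1 i => exact hv i
    | ih2 a b iha ihb => exact L.isGradedLie.br_mem iha ihb
  have h2 : grNA deg n ≤ (L.gr n).comap (evalNA L v) := grNA_le fun a ha => by
    subst ha
    rw [Submodule.mem_comap, evalNA_mon]
    exact h a
  exact h2 hx

/-- Monomials are sent to elements of the same degree, so the signs in the relators are those of the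
identities holding in `L`. -/
lemma relIdeal_le_ker_evalNA (hv : ∀ i, v i ∈ L.gr (deg i)) :
    relIdeal deg ≤ LinearMap.ker (evalNA L v) := by
  have hm : ∀ a, evalNA L v (mon a) ∈ L.gr (mdeg deg a) := fun a => evalNA_mem hv (mon_mem deg a)
  refine Submodule.span_le.2 fun r hr => ?_
  change evalNA L v r = 0
  induction hr with
  | anti a b =>
    rw [map_add, map_smul, evalNA_mul, evalNA_mul, L.isGradedLie.br_anti (hm a) (hm b)]
    exact neg_add_cancel _
  | jacobi a b c =>
    simp only [map_sub, map_smul, evalNA_mul]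
    rw [L.isGradedLie.jacobi (hm a) (hm b) (hm c)]
    abel
  | mul_left a _ ih => rw [evalNA_mul, ih, map_zero]
  | mul_right a _ ih => rw [evalNA_mul, ih, map_zero, LinearMap.zero_apply]

/-- Both sides obey the same Leibniz rule, so agreement on generators propagates to monomials. -/
lemma evalNA_derNA (hv : ∀ i, v i ∈ L.gr (deg i)) {δ : ι → FreeMagma ι →₀ ℚ}
    (h : ∀ i, L.d (v i) = evalNA L v (δ i)) (x : FreeMagma ι →₀ ℚ) :
    evalNA L v (derNA deg δ x) = L.d (evalNA L v x) := by
  refine lin_ext (S := LinearMap.eqLocus (evalNA L v ∘ₗ derNA deg δ) (L.d ∘ₗ evalNA L v))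
    (fun a => ?_) x
  change evalNA L v (derNA deg δ (mon a)) = L.d (evalNA L v (mon a))
  rw [derNA_mon, evalNA_mon]
  induction a with
  | ih1 i => exact (h i).symm
  | ih2 a b iha ihb =>
    have hm := evalNA_mem hv (mon_mem deg a)
    rw [evalNA_mon] at hm
    change evalNA L v (mulNA (derMon deg δ a) (mon b) +
      (-1 : ℚ) ^ mdeg deg a • mulNA (mon a) (derMon deg δ b)) =
      L.d (L.br (evalMon L v a) (evalMon L v b))
    rw [L.isDerivation.leibniz _ hm, map_add, map_smul, evalNA_mul, evalNA_mul, iha, ihb,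
      evalNA_mon, evalNA_mon]

/-- The morphism from a free differential graded Lie algebra with prescribed values on generators. -/
noncomputable def liftHom (deg : ι → ℤ) (δ : ι → FreeMagma ι →₀ ℚ)
    (hδ : ∀ i, δ i ∈ grNA deg (deg i - 1))
    (h0 : ∀ i, der deg δ hδ (der deg δ hδ (gen deg i)) = 0) (hv : ∀ i, v i ∈ L.gr (deg i))
    (h : ∀ i, L.d (v i) = evalNA L v (δ i)) : DGLie.Hom (freeDGLie deg δ hδ h0) L where
  toFun := (relIdeal deg).liftQ (evalNA L v) (relIdeal_le_ker_evalNA hv)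
  map_gr := by
    rintro n _ ⟨x, hx, rfl⟩
    exact evalNA_mem hv hx
  map_br x y := by
    obtain ⟨x, rfl⟩ := (relIdeal deg).mkQ_surjective x
    obtain ⟨y, rfl⟩ := (relIdeal deg).mkQ_surjective y
    exact evalNA_mul x y
  map_d x := by
    obtain ⟨x, rfl⟩ := (relIdeal deg).mkQ_surjective x
    exact evalNA_derNA hv h x

end FreeGradedLie

/-! ### Lifting morphisms out of `LieU n` up to homotopy -/

namespace FatWedge

variable {k : ℕ} {n : Fin k → ℤ}

/-- Only nonempty proper subsets of `S` occur in the sum: `A` contains the least element and is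
proper, so `S \ A` is nonempty and proper too. Asking for agreement only there is what permits
induction over subsets. -/
lemma map_shuffleSum {V W : Type*} [AddCommGroup V] [Module ℚ V] [AddCommGroup W] [Module ℚ W]
    {b : V →ₗ[ℚ] V →ₗ[ℚ] V} {b' : W →ₗ[ℚ] W →ₗ[ℚ] W} (f : V →ₗ[ℚ] W)
    (hf : ∀ x y, f (b x y) = b' (f x) (f y)) {v : Finset (Fin k) → V} {v' : Finset (Fin k) → W}
    {S : Finset (Fin k)} (h : ∀ A ⊂ S, A.Nonempty → f (v A) = v' A) :
    f (shuffleSum n b v S) = shuffleSum n b' v' S := by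
  rw [shuffleSum, shuffleSum, map_sum]
  refine Finset.sum_congr rfl fun A hA => ?_
  rw [Finset.mem_filter, Finset.mem_ssubsets] at hA
  obtain ⟨hA, m, hm, -⟩ := hA
  rw [map_smul, hf, h A hA ⟨m, hm⟩,
    h (S \ A) (Finset.sdiff_ssubset hA.1 ⟨m, hm⟩) (Finset.sdiff_nonempty.2 hA.2)]

lemma shuffleSum_congr {V : Type*} [AddCommGroup V] [Module ℚ V]
    {b : V →ₗ[ℚ] V →ₗ[ℚ] V} {v v' : Finset (Fin k) → V}
    {S : Finset (Fin k)} (h : ∀ A ⊂ S, A.Nonempty → v A = v' A) :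
    shuffleSum n b v S = shuffleSum n b v' S :=
  map_shuffleSum LinearMap.id (fun _ _ => rfl) h

/-- Morphisms out of `Lie(U)` are determined by families of elements satisfying the
differential relations. -/
lemma exists_hom (L : DGLie.{v}) (v : Finset (Fin k) → L.carrier)
    (hv : ∀ S, v S ∈ L.gr (udeg n S))
    (h : ∀ S : Finset (Fin k), S.Nonempty → S ≠ Finset.univ → L.d (v S) = shuffleSum n L.br v S) :
    ∃ Φ : DGLie.Hom (LieU n) L,
      ∀ S : Finset (Fin k), S.Nonempty → S ≠ Finset.univ → Φ.toFun (u n S) = v S := by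
  have hgen : ∀ S : Finset (Fin k), S.Nonempty → S ≠ Finset.univ →
      FreeGradedLie.evalNA L (fun S : Index k => v S.1) (genNA S) = v S := by
    intro S hS hS'
    rw [genNA, dif_pos ⟨hS, hS'⟩, FreeGradedLie.evalNA_mon]
    rfl
  refine ⟨FreeGradedLie.liftHom (deg n) (δ n) (δ_mem n) _ (v := fun S : Index k => v S.1)
    (fun S => hv S.1) fun S => ?_, hgen⟩
  rw [h S.1 S.2.1 S.2.2, δ]
  exact (map_shuffleSum _ FreeGradedLie.evalNA_mul fun A hA hAn =>
    hgen A hAn (hA.trans_subset (Finset.subset_univ _)).ne).symm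

lemma d_map_u {L : DGLie.{v}} (ψ : DGLie.Hom (LieU n) L) {S : Finset (Fin k)} (hS : S.Nonempty)
    (hS' : S ≠ Finset.univ) :
    L.d (ψ.toFun (u n S)) = shuffleSum n L.br (fun A => ψ.toFun (u n A)) S := by
  rw [← ψ.map_d, d_u n hS hS']
  exact map_shuffleSum ψ.toFun ψ.map_br fun _ _ _ => rfl

variable {L : DGLie.{u}} {L' : DGLie.{v}}

/-- `y` and `γ` are the values at `u_S` of a morphism to `L` and of a homotopy from `ψ` to its
composition with `φ`, given the values `v` and `Γ` at the generators `u_A` with `A ⊂ S`. -/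
structure IsLiftAt (φ : DGLie.Hom L L') (ψ : DGLie.Hom (LieU n) L')
    (v : Finset (Fin k) → L.carrier)
    (Γ : Finset (Fin k) → L'.PathObject) (S : Finset (Fin k)) (y : L.carrier) (γ : L'.PathObject) : Prop where
  d_left : L.d y = shuffleSum n L.br v S
  d_path : L'.pathD γ = shuffleSum n L'.pathBr Γ S
  ev_zero : PolyLie.ev 0 γ.1 = ψ.toFun (u n S)
  ev_one : PolyLie.ev 1 γ.1 = φ.toFun y

variable {φ : DGLie.Hom L L'} {ψ : DGLie.Hom (LieU n) L'} {v : Finset (Fin k) → L.carrier}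
  {Γ : Finset (Fin k) → L'.PathObject}

/-- Setting `t = c` and `dt = 0` respects brackets. -/
lemma ev_shuffleSum (L : DGLie.{v}) (c : ℚ)
    {Γ : Finset (Fin k) → L.PathObject}
    {v : Finset (Fin k) → L.carrier} {S : Finset (Fin k)}
    (h : ∀ A ⊂ S, A.Nonempty → PolyLie.ev c (Γ A).1 = v A) :
    PolyLie.ev c (shuffleSum n L.pathBr Γ S).1 = shuffleSum n L.br v S :=
  map_shuffleSum (b := L.pathBr) (b' := L.br)
    (PolyLie.ev c ∘ₗ LinearMap.fst ℚ (ℚ[X] ⊗[ℚ] L.carrier) (ℚ[X] ⊗[ℚ] L.carrier))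
    (L.ev_pathBr c) h

lemma path_shuffleSum_mem (L : DGLie.{v}) {Γ : Finset (Fin k) → L.PathObject}
    (hΓ : ∀ A, Γ A ∈ L.pathGr (udeg n A)) (S : Finset (Fin k)) :
    shuffleSum n L.pathBr Γ S ∈ L.pathGr (udeg n S - 1) :=
  shuffleSum_mem (gr := L.pathGr) (br := L.pathBr)
    (fun hx hy => L.path_isGradedLie.br_mem hx hy) hΓ

lemma exists_isLiftAt (hφ : φ.IsQuasiIso) (hv : ∀ A, v A ∈ L.gr (udeg n A))
    (hΓ : ∀ A, Γ A ∈ L'.pathGr (udeg n A)) {S : Finset (Fin k)}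
    (hS : S.Nonempty) (hS' : S ≠ Finset.univ)
    (h : ∀ A ⊂ S, A.Nonempty → IsLiftAt φ ψ v Γ A (v A) (Γ A)) :
    ∃ y ∈ L.gr (udeg n S), ∃ γ ∈ L'.pathGr (udeg n S), IsLiftAt φ ψ v Γ S y γ := by
  have hc := d_shuffleSum L'.path_isGradedLie L'.path_isDerivation (fun A _ => hΓ A) S
    fun A hA hAn => (h A hA hAn).d_path
  have hcm := path_shuffleSum_mem L' hΓ S
  have hc' := d_shuffleSum L.isGradedLie L.isDerivation (fun A _ => hv A) S
    fun A hA hAn => (h A hA hAn).d_left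
  have hcm' := shuffleSum_mem (gr := L.gr) (br := L.br) (n := n) (S := S)
    (fun hx hy => L.isGradedLie.br_mem hx hy) hv
  have hu : ψ.toFun (u n S) ∈ L'.gr (udeg n S) := ψ.map_gr (gen_mem n S)
  -- The shuffle sum of the paths starts at the shuffle sum of the `ψ(u_A)`, which is `d ψ(u_S)`.
  obtain ⟨γ, hγ, hdγ, h0⟩ := DGLie.exists_path_of_cycle hcm hc hu (by
    rw [d_map_u ψ hS hS', ev_shuffleSum L' 0 fun A hA hAn => (h A hA hAn).ev_zero])
  -- The endpoint of `γ` is a primitive of `φ` of the shuffle sum of the `v A`; it plays the role of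
  -- `y'`.
  obtain ⟨y, hy, hdy, e, he, hde⟩ := hφ.exists_primitive hc' hcm' (PolyLie.ev_mem 1 hγ.1) (by
    rw [← PolyLie.ev_lTensor, map_shuffleSum φ.toFun φ.map_br fun _ _ _ => rfl,
      ← ev_shuffleSum L' 1 fun A hA hAn => (h A hA hAn).ev_one, ← hdγ]
    rfl)
  -- Adding the cycle `ε` moves the endpoint of `γ` by `d e`, exactly onto `φ(y)`, and changes
  -- neither its differential nor its starting point.
  obtain ⟨ε, hε, hdε, hε0, hε1⟩ := DGLie.exists_path_cycle_of_boundary he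
  refine ⟨y, hy, γ + ε, Submodule.add_mem _ hγ hε, hdy, ?_, ?_, ?_⟩
  · rw [map_add, hdε, add_zero, hdγ]
  · rw [Prod.fst_add, map_add, h0, hε0, add_zero]
  · rw [Prod.fst_add, map_add, hε1, hde]
    abel

/-- The families enter only through proper subsets of `S`, while the values at `S` are the separate
arguments `y` and `γ`. Hence the families may be redefined at `S` and on larger sets. -/
lemma IsLiftAt.congr {v' : Finset (Fin k) → L.carrier}
    {Γ' : Finset (Fin k) → L'.PathObject}
    {S : Finset (Fin k)} {y γ} (h : IsLiftAt φ ψ v Γ S y γ) (hv : ∀ A ⊂ S, v A = v' A)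
    (hΓ : ∀ A ⊂ S, Γ A = Γ' A) : IsLiftAt φ ψ v' Γ' S y γ where
  d_left := h.d_left.trans (shuffleSum_congr fun A hA _ => hv A hA)
  d_path := h.d_path.trans (shuffleSum_congr fun A hA _ => hΓ A hA)
  ev_zero := h.ev_zero
  ev_one := h.ev_one

lemma exists_lift (hφ : φ.IsQuasiIso) (ψ : DGLie.Hom (LieU n) L') :
    ∃ (v : Finset (Fin k) → L.carrier)
      (Γ : Finset (Fin k) → L'.PathObject),
      (∀ A, v A ∈ L.gr (udeg n A)) ∧ (∀ A, Γ A ∈ L'.pathGr (udeg n A)) ∧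
      ∀ S : Finset (Fin k), S.Nonempty → S ≠ Finset.univ → IsLiftAt φ ψ v Γ S (v S) (Γ S) := by
  suffices H : ∀ m : ℕ, ∃ (v : Finset (Fin k) → L.carrier)
      (Γ : Finset (Fin k) → L'.PathObject),
      (∀ A, v A ∈ L.gr (udeg n A)) ∧ (∀ A, Γ A ∈ L'.pathGr (udeg n A)) ∧
      ∀ S : Finset (Fin k), S.card < m → S.Nonempty → S ≠ Finset.univ →
        IsLiftAt φ ψ v Γ S (v S) (Γ S) by
    -- Every subset of `Fin k` has fewer than `k + 1` elements.
    obtain ⟨v, Γ, hv, hΓ, h⟩ := H (k + 1)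
    exact ⟨v, Γ, hv, hΓ, fun S => h S (Nat.lt_succ_of_le (card_finset_fin_le S))⟩
  intro m
  induction m with
  | zero => exact ⟨0, 0, fun A => Submodule.zero_mem _, fun A => Submodule.zero_mem _, by simp⟩
  | succ m ih =>
    obtain ⟨v, Γ, hv, hΓ, h⟩ := ih
    -- Stated for all `S`, with value `0` where nothing is required, so that `choose` yields
    -- families homogeneous everywhere.
    have key : ∀ S : Finset (Fin k), ∃ y ∈ L.gr (udeg n S), ∃ γ ∈ L'.pathGr (udeg n S),
        S.card ≤ m → S.Nonempty → S ≠ Finset.univ → IsLiftAt φ ψ v Γ S y γ := by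
      intro S
      by_cases hS : S.card ≤ m ∧ S.Nonempty ∧ S ≠ Finset.univ
      · obtain ⟨y, hy, γ, hγ, hl⟩ := exists_isLiftAt (ψ := ψ) hφ hv hΓ hS.2.1 hS.2.2
          fun A hA hAn => h A ((Finset.card_lt_card hA).trans_le hS.1) hAn
            (hA.trans_subset (Finset.subset_univ _)).ne
        exact ⟨y, hy, γ, hγ, fun _ _ _ => hl⟩
      · exact ⟨0, Submodule.zero_mem _, 0, Submodule.zero_mem _,
          fun h1 h2 h3 => absurd ⟨h1, h2, h3⟩ hS⟩
    choose y hy γ hγ hl using key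
    refine ⟨fun S => if S.card < m then v S else y S, fun S => if S.card < m then Γ S else γ S,
      fun A => ?_, fun A => ?_, fun S hSm hS hS' => ?_⟩
    · dsimp only
      split_ifs
      exacts [hv A, hy A]
    · dsimp only
      split_ifs
      exacts [hΓ A, hγ A]
    -- The new families keep the old values on sets with fewer than `m` elements, in particular on
    -- all proper subsets of `S`.
    · have hlt : ∀ A ⊂ S, A.card < m := fun A hA =>
        (Finset.card_lt_card hA).trans_le (Nat.le_of_lt_succ hSm)
      have hlS : IsLiftAt φ ψ v Γ S (if S.card < m then v S else y S)
          (if S.card < m then Γ S else γ S) := by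
        split_ifs with hc
        · exact h S hc hS hS'
        · exact hl S (Nat.le_of_lt_succ hSm) hS hS'
      exact hlS.congr (fun A hA => (if_pos (hlt A hA)).symm) fun A hA => (if_pos (hlt A hA)).symm

/-- Morphisms from `Lie(U)` lift along quasi-isomorphisms, up to homology at the `u_i` and `w`. -/
lemma exists_hom_lift (hφ : φ.IsQuasiIso) (ψ : DGLie.Hom (LieU n) L') :
    ∃ Φ : DGLie.Hom (LieU n) L,
      (∀ i, φ.mapH _ (Φ.mapH _ (uClass n i)) = ψ.mapH _ (uClass n i)) ∧
      φ.mapH _ (Φ.mapH _ (wClass n)) = ψ.mapH _ (wClass n) := by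
  obtain ⟨v, Γ, hv, hΓ, h⟩ := exists_lift hφ ψ
  obtain ⟨Φ, hΦ⟩ := exists_hom L v hv fun S hS hS' => (h S hS hS').d_left
  refine ⟨Φ, fun i => ?_, ?_⟩
  · rw [uClass, DGLie.Hom.mapH_cls, DGLie.Hom.mapH_cls, DGLie.Hom.mapH_cls, DGLie.cls_eq_cls_iff]
    -- If `{i}` is the whole set (`k = 1`), it indexes no generator and `u n {i}` is the default
    -- value `0`.
    by_cases hi : ({i} : Finset (Fin k)) = Finset.univ
    · have h0 : u n {i} = 0 := by
        change (FreeGradedLie.relIdeal (deg n)).mkQ (genNA {i}) = 0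
        rw [genNA, dif_neg fun h' => h'.2 hi, map_zero]
      exact ⟨0, Submodule.zero_mem _, by simp [h0]⟩
    · have hl := h {i} (Finset.singleton_nonempty i) hi
      have hm := hΓ {i}
      rw [udeg, Finset.sum_singleton] at hm
      -- A singleton has no decomposition into two nonempty parts, so its path is a cycle and joins
      -- homologous elements.
      have hd : L'.pathD (Γ {i}) = 0 := by
        rw [hl.d_path, shuffleSum]
        refine Finset.sum_eq_zero fun A hA => ?_
        rw [Finset.mem_filter, Finset.mem_ssubsets, Finset.ssubset_singleton_iff] at hA
        obtain ⟨rfl, m, hm, -⟩ := hA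
        exact absurd hm (Finset.notMem_empty m)
      have := DGLie.exists_d_eq_of_path_cycle hm hd
      rwa [hl.ev_zero, hl.ev_one, ← hΦ _ (Finset.singleton_nonempty i) hi] at this
  · rw [wClass, DGLie.Hom.mapH_cls, DGLie.Hom.mapH_cls, DGLie.Hom.mapH_cls, DGLie.cls_eq_cls_iff]
    have hl : ∀ A ⊂ (Finset.univ : Finset (Fin k)), A.Nonempty →
        IsLiftAt φ ψ v Γ A (v A) (Γ A) := fun A hA hAn => h A hAn hA.ne
    -- No path is chosen for the whole set: the shuffle sum itself is the cycle joining `ψ(w)` to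
    -- `φ(Φ(w))`.
    have hc := d_shuffleSum L'.path_isGradedLie L'.path_isDerivation (fun A _ => hΓ A) Finset.univ
      fun A hA hAn => (hl A hA hAn).d_path
    have hm := path_shuffleSum_mem L' hΓ Finset.univ
    rw [udeg, sub_sub, one_add_one_eq_two] at hm
    have := DGLie.exists_d_eq_of_path_cycle hm hc
    rw [ev_shuffleSum L' 0 fun A hA hAn => (hl A hA hAn).ev_zero,
      ev_shuffleSum L' 1 fun A hA hAn => (hl A hA hAn).ev_one,
      ← map_shuffleSum φ.toFun φ.map_br fun A _ _ => rfl,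
      ← map_shuffleSum Φ.toFun Φ.map_br fun A hA hAn => hΦ A hAn hA.ne,
      ← map_shuffleSum ψ.toFun ψ.map_br fun A _ _ => rfl] at this
    exact this

end FatWedge

/-! ### Comparison of the bracket sets -/

lemma bijOn_whiteheadBracket {k : ℕ} {n : Fin k → ℤ} {L : DGLie.{u}} {L' : DGLie.{v}}
    {φ : DGLie.Hom L L'} (hφ : φ.IsQuasiIso) (x : ∀ i, L.H (n i - 1)) :
    Set.BijOn (φ.mapH (∑ i, n i - 2)) (whiteheadBracket L x)
      (whiteheadBracket L' fun i => φ.mapH (n i - 1) (x i)) := by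
  refine ⟨?_, (hφ _).1.injOn, ?_⟩
  · rintro _ ⟨Φ, hΦ, rfl⟩
    exact ⟨φ.comp Φ, fun i => by rw [DGLie.Hom.mapH_comp, hΦ i], DGLie.Hom.mapH_comp _ _ _ _⟩
  · rintro _ ⟨ψ, hψ, rfl⟩
    obtain ⟨Φ, h1, h2⟩ := FatWedge.exists_hom_lift hφ ψ
    -- Injectivity of `φ_*` in degree `n i - 1` shows that `Φ(u_i)` represents `x i` itself, not
    -- merely a class with the same image.
    exact ⟨_, ⟨Φ, fun i => (hφ _).1 ((h1 i).trans (hψ i)), rfl⟩, h2⟩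

theorem proposition1p4 {k : ℕ} (hk : 2 ≤ k) (n : Fin k → ℤ) (L : DGLie.{u}) (L' : DGLie.{v})
    (φ : DGLie.Hom L L') (hφ : φ.IsQuasiIso) (x : ∀ i, L.H (n i - 1)) :
    ((0 : L.H (∑ i, n i - 2)) ∈ whiteheadBracket L x ↔
      (0 : L'.H (∑ i, n i - 2)) ∈ whiteheadBracket L' fun i => φ.mapH (n i - 1) (x i)) ∧
    Set.BijOn (φ.mapH (∑ i, n i - 2)) (whiteheadBracket L x)
      (whiteheadBracket L' fun i => φ.mapH (n i - 1) (x i)) ∧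
    Cardinal.lift.{v} (Cardinal.mk (whiteheadBracket L x)) =
      Cardinal.lift.{u} (Cardinal.mk (whiteheadBracket L' fun i => φ.mapH (n i - 1) (x i))) := by
  have h := bijOn_whiteheadBracket hφ x
  refine ⟨⟨fun h0 => ?_, fun h0 => ?_⟩, h, Cardinal.lift_mk_eq'.2 ⟨Set.BijOn.equiv _ h⟩⟩
  · simpa using h.mapsTo h0
  · obtain ⟨y, hy, hy0⟩ := h.surjOn h0
    have : y = 0 := (hφ _).1 (hy0.trans (map_zero _).symm)
    exact this ▸ hy
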